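/- **Setting.** Let $G=\mathrm{PSL}(2,\mathbb R)$ carry the distance $d_G$ of the left-invariant Riemannian metric given at the identity by $\langle A,B\rangle=\operatorname{tr}(A^{\top}B)$ on $\mathfrak{sl}(2,\mathbb R)$. Let $\Gamma\subset G$ be a discrete subgroup whose elements other than the identity $e$ act without fixed points on the hyperbolic plane, such that $X=\Gamma\backslash G$ is compact. Put $$d_X(x,y)=\inf\{d_G(g,h):\ x=\Gamma g,\ y=\Gamma h\},$$ and let $a_t,b_s,c_u,d_\pi\in G$ be the classes of $$\begin{pmatrix}e^{t/2}&0\\0&e^{-t/2}\end{pmatrix},\quad \begin{pmatrix}1&s\\0&1\end{pmatrix},\quad \begin{pmatrix}1&0\\u&1\end{pmatrix},\quad \begin{pmatrix}0&1\\-1&0\end{pmatrix}.$$ The geodesic flow is $\varphi_t(\Gamma g)=\Gamma ga_t$ and the time reversal is $\mathcal T(\Gamma g)=\Gamma gd_\pi$. Write $z=(u,s)_x$ if $x=\Gamma g$ and $z=\Gamma gc_ub_s$ for some $g$, and let $\mathcal P_\delta(x)=\{(u,s)_x:\ |u|,|s|<\delta\}$. A $T$-periodic orbit is the orbit of a point $x$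 with $\varphi_T(x)=x$, where $T>0$ is a period, not necessarily the smallest one. *The constants.* Let $\sigma_0>0$ be any number such that $d_G(\gamma g,g)>\sigma_0$ for all $\gamma\in\Gamma\setminus\{e\}$ and $g\in G$. Call $\varepsilon_*>0$ a *coincidence constant* if the following holds for all $\delta\in(0,\varepsilon_*)$: whenever $x_1,x_2$ have periods $\tau_1,\tau_2>0$ with $|\tau_1-\tau_2|\le\sqrt2\,\delta$ and $d_X(\varphi_t(x_1),\varphi_t(x_2))<\delta$ for all $t\in[0,\min\{\tau_1,\tau_2\}]$, then $\tau_1=\tau_2$ and the two orbits are identical. *Partner orbits.* A $T$-periodic orbit $c$ and a $T'$-periodic orbit $c'$ are *$\eta$-partners* if there are $L\ge2$, points $x\in c$, $x'\in c'$, decompositions $0=t_0<\dots<t_L=T$ and $0=t'_0<\dots<t'_L=T'$, and a permutation $\sigma$ of $\{0,\dots,L-1\}$ such that for each $j$ one of the following holds: - $d_X(\varphi_{t+t_j}(x),\varphi_{t+t'_{\sigma(j)}}(x'))<\eta$ for all $t\in[0,t_{j+1}-t_j]$; - $d_X(\varphi_{t+t_j}(x),\varphi_{t-t'_{\sigma(j)+1}}(\mathcal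 T(x')))<\eta$ for all $t\in[0,t_{j+1}-t_j]$. *Reconnection.* Let $x$ lie on a $T$-periodic orbit with $T=T_1+T_2+T_3+T_4$, all $T_i>0$. A $T'$-periodic orbit $c'$, with data $x'\in c'$ and $0=t_0'<t_1'<t_2'<t_3'<t_4'=T'$, is an *$\eta$-partner reconnected in both encounters* if the partner condition holds with $L=4$ and the following choices. - The first orbit is cut into the pieces of lengths $T_1,T_2,T_3,T_4$ (in this order, starting at $x$). - The four successive pieces of $c'$ starting at $x'$ correspond to the first piece, the time-reversed third piece, the time-reversed fourth piece, and the second piece. - Corresponding pieces differ in length by less than $\varepsilon$. **Theorem.** A coincidence constant $\varepsilon_*$ exists. Let $\varepsilon\in(0,\sigma_0/20)$, and let $c$ be a $T$-periodic orbit with $T>1$ that has one $(2,\varepsilon)$-parallel and one $(2,\varepsilon)$-antiparallel encounter, intertwined, in the following sense. There are $x,y,z,w\in c$ and $T_1,T_2,T_3,T_4>0$ with $T_1+T_2+T_3+T_4=T$ such that $\varphi_{T_1}(x)=y$, $\varphi_{T_2}(y)=z$, $\varphi_{T_3}(z)=w$, $\varphi_{T_4}(w)=x$, and $$z=(u_1,s_1)_x\in\mathcal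 P_\varepsilon(x),\qquad \mathcal T(w)=(u_2,s_2)_y\in\mathcal P_\varepsilon(y)$$ (with $|u_i|,|s_i|<\varepsilon$), where $$|u_1|>9\varepsilon e^{-T_3},\qquad |s_1|>72\varepsilon^3+5\varepsilon e^{-T_4}+2\varepsilon e^{-T_2}.$$ Then $c$ has a $19\varepsilon$-partner orbit $c'$, of some period $T'$, which differs from $c$ in both encounters. That is, there are data $x',t'_0,\dots,t'_4$ such that: 1. $c'$ is a $19\varepsilon$-partner of $c$ reconnected in both encounters; 2. in each of its four passages through the encounters, $c'$ crosses the Poincaré section away from the two points of $c$ defining the encounter: there are $\tau_0,\dots,\tau_3$ with $|\tau_i-t'_i|<\varepsilon$ such that $$\varphi_{\tau_0}(x'),\ \mathcal T(\varphi_{\tau_2}(x'))\in\mathcal P_{5\varepsilon}(x)\setminus\{x,z\},\qquad \varphi_{\tau_1}(x'),\ \varphi_{\tau_3}(x')\in\mathcal P_{5\varepsilon}(y)\setminus\{y,\mathcal T(w)\};$$ 3. the action difference satisfies $$\left|\frac{T'-T}{2}-\ln\big((1+s_1u_1)(1+s_2u_2)\big)\right|\le 54\varepsilon^4+25\varepsilon^2\left(e^{-T_1}+e^{-T_2}+e^{-T_3}+e^{-T_4}\right).$$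 If moreover $\varepsilon<\varepsilon_*/38$ for some coincidence constant $\varepsilon_*$, then the partner is unique: any two $19\varepsilon$-partners of $c$ reconnected in both encounters (with respect to $x,T_1,\dots,T_4$) have the same period and are the same orbit. -/

import Mathlib

open scoped MatrixGroups UpperHalfPlane

namespace HadamardGutzwiller

/-- The group `PSL(2, ℝ) = SL(2, ℝ) / {± 1}`. -/
abbrev PSL2R : Type := Matrix.ProjectiveSpecialLinearGroup (Fin 2) ℝ

/-- The diagonal matrix with entries `e^{t/2}`, `e^{-t/2}`. -/
noncomputable def aMat (t : ℝ) : SL(2, ℝ) :=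
  ⟨!![Real.exp (t / 2), 0; 0, Real.exp (-t / 2)], by
    rw [Matrix.det_fin_two_of, ← Real.exp_add, mul_zero, sub_zero,
      show t / 2 + -t / 2 = 0 by ring, Real.exp_zero]⟩

/-- The class of `aMat t` in `PSL(2, ℝ)`. -/
noncomputable def a (t : ℝ) : PSL2R :=
  QuotientGroup.mk (aMat t)

/-- The upper triangular unipotent matrix with entry `s`. -/
noncomputable def bMat (s : ℝ) : SL(2, ℝ) :=
  ⟨!![1, s; 0, 1], by simp [Matrix.det_fin_two_of]⟩

/-- The class of `bMat s` in `PSL(2, ℝ)` (stable direction). -/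
noncomputable def b (s : ℝ) : PSL2R :=
  QuotientGroup.mk (bMat s)

/-- The lower triangular unipotent matrix with entry `u`. -/
noncomputable def cMat (u : ℝ) : SL(2, ℝ) :=
  ⟨!![1, 0; u, 1], by simp [Matrix.det_fin_two_of]⟩

/-- The class of `cMat u` in `PSL(2, ℝ)` (unstable direction). -/
noncomputable def c (u : ℝ) : PSL2R :=
  QuotientGroup.mk (cMat u)

/-- The matrix of the time reversal. -/
noncomputable def dPiMat : SL(2, ℝ) :=
  ⟨!![0, 1; -1, 0], by simp [Matrix.det_fin_two_of]⟩

/-- The class of `dPiMat` in `PSL(2, ℝ)`. -/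
noncomputable def dPi : PSL2R :=
  QuotientGroup.mk (dPiMat)

/-- The length of a curve in `SL(2, ℝ)` for the left-invariant Riemannian metric which at the
identity is `⟨A, B⟩ = tr (Aᵀ B)`: the integral of the norm of `(γ t)⁻¹ γ'(t)`. -/
noncomputable def curveLength (γ : ℝ → SL(2, ℝ)) : ℝ :=
  ∫ t in (0 : ℝ)..1,
    let A : Matrix (Fin 2) (Fin 2) ℝ :=
      ((γ t)⁻¹ : SL(2, ℝ)).1 * Matrix.of fun i j => deriv (fun r => (γ r).1 i j) t
    Real.sqrt (Matrix.trace (A.transpose * A))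

/-- The left-invariant Riemannian distance on `PSL(2, ℝ)`: the infimum of the lengths of `C¹`
curves, each curve being lifted to the double cover `SL(2, ℝ)`. -/
noncomputable def dG (g h : PSL2R) : ℝ :=
  sInf {l : ℝ | ∃ γ : ℝ → SL(2, ℝ), (∀ i j, ContDiff ℝ 1 fun t => (γ t).1 i j) ∧
    (γ 0 : PSL2R) = g ∧ (γ 1 : PSL2R) = h ∧ l = curveLength γ}

/-- The phase space `X = Γ \ PSL(2, ℝ)`, the space of right cosets `Γ g`. -/
abbrev X (Γ : Subgroup PSL2R) : Type := Quotient (QuotientGroup.rightRel Γ)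

variable (Γ : Subgroup PSL2R)

/-- The projection `g ↦ Γ g`. -/
def proj (g : PSL2R) : X Γ := Quotient.mk (QuotientGroup.rightRel Γ) g

/-- Right multiplication `Γ g ↦ Γ g p`. -/
def rightMul (p : PSL2R) : X Γ → X Γ :=
  Quotient.map (fun g => g * p) fun g h hgh => by
    change QuotientGroup.rightRel Γ (g * p) (h * p)
    have h' : QuotientGroup.rightRel Γ g h := hgh
    rw [QuotientGroup.rightRel_apply] at h' ⊢
    simpa [mul_assoc] using h'

/-- The geodesic flow `φ_t (Γ g) = Γ g a_t`. -/
noncomputable def flow (t : ℝ) : X Γ → X Γ := rightMul Γ (a t)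

/-- The time reversal `T (Γ g) = Γ g d_π`. -/
noncomputable def timeRev : X Γ → X Γ := rightMul Γ dPi

/-- The distance on `X`: the infimum of `dG` over all representatives. -/
noncomputable def dX (x y : X Γ) : ℝ :=
  sInf {r : ℝ | ∃ g h : PSL2R, proj Γ g = x ∧ proj Γ h = y ∧ r = dG g h}

/-- `z = (u, s)_x`, that is, `z = Γ g c_u b_s` where `x = Γ g`. -/
def HasCoords (x : X Γ) (u s : ℝ) (z : X Γ) : Prop :=
  ∃ g : PSL2R, proj Γ g = x ∧ proj Γ (g * c u * b s) = z

/-- The Poincaré section of radius `ε` at `x`. -/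
def poincareSection (ε : ℝ) (x : X Γ) : Set (X Γ) :=
  {z | ∃ u s : ℝ, |u| < ε ∧ |s| < ε ∧ HasCoords Γ x u s z}

/-- The orbit of a point under the flow. -/
def orbit (x : X Γ) : Set (X Γ) := Set.range fun t : ℝ => flow Γ t x

/-- `O` is a `T`-periodic orbit (`T > 0` is a period, not necessarily the smallest one). -/
def IsPeriodicOrbit (O : Set (X Γ)) (T : ℝ) : Prop :=
  0 < T ∧ ∃ x : X Γ, flow Γ T x = x ∧ O = orbit Γ x

/-- The elements of `Γ` other than the identity act on the hyperbolic plane without fixed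
points. -/
def ActsFreely : Prop :=
  ∀ A : SL(2, ℝ), (A : PSL2R) ∈ Γ → (A : PSL2R) ≠ 1 → ∀ z : ℍ, A • z ≠ z

/-- `σ₀ > 0` is a lower bound for the displacement of all nontrivial elements of `Γ`. -/
def IsDisplacementBound (σ₀ : ℝ) : Prop :=
  0 < σ₀ ∧ ∀ γ ∈ Γ, γ ≠ 1 → ∀ g : PSL2R, σ₀ < dG (γ * g) g

/-- `εs > 0` is a constant of expansivity for periodic orbits: periodic points with nearly equal
periods whose orbits stay `ε`-close, for some `ε < εs`, have the same period and orbit. -/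
def IsCoincidenceConst (εs : ℝ) : Prop :=
  0 < εs ∧ ∀ ε : ℝ, 0 < ε → ε < εs → ∀ (x₁ x₂ : X Γ) (T₁ T₂ : ℝ), 0 < T₁ → 0 < T₂ →
    flow Γ T₁ x₁ = x₁ → flow Γ T₂ x₂ = x₂ → |T₁ - T₂| ≤ Real.sqrt 2 * ε →
    (∀ t ∈ Set.Icc 0 (min T₁ T₂), dX Γ (flow Γ t x₁) (flow Γ t x₂) < ε) →
    T₁ = T₂ ∧ orbit Γ x₁ = orbit Γ x₂

/-- The `j`-th piece `[t j, t (j+1)]` of the orbit through `x` is `η`-close to the `σ j`-th piece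
of the orbit through `x'`, which is run backwards if `rev j = true`. -/
def PiecewiseClose (η : ℝ) {L : ℕ} (t t' : Fin (L + 1) → ℝ) (σ : Equiv.Perm (Fin L))
    (rev : Fin L → Bool) (x x' : X Γ) : Prop :=
  ∀ j : Fin L, ∀ r ∈ Set.Icc 0 (t j.succ - t j.castSucc),
    (rev j = false →
      dX Γ (flow Γ (r + t j.castSucc) x) (flow Γ (r + t' (σ j).castSucc) x') < η) ∧
    (rev j = true →
      dX Γ (flow Γ (r + t j.castSucc) x) (flow Γ (r - t' (σ j).succ) (timeRev Γ x')) < η)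

/-- The `T`-periodic orbit `O` and the `T'`-periodic orbit `O'` form an `η`-orbit pair, that is,
`O'` is an `η`-partner orbit of `O`. -/
def IsPartnerOrbit (η : ℝ) (O : Set (X Γ)) (T : ℝ) (O' : Set (X Γ)) (T' : ℝ) : Prop :=
  IsPeriodicOrbit Γ O T ∧ IsPeriodicOrbit Γ O' T' ∧
  ∃ (L : ℕ) (t t' : Fin (L + 1) → ℝ) (σ : Equiv.Perm (Fin L)) (rev : Fin L → Bool)
    (x x' : X Γ), 2 ≤ L ∧ StrictMono t ∧ t 0 = 0 ∧ t (Fin.last L) = T ∧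
    StrictMono t' ∧ t' 0 = 0 ∧ t' (Fin.last L) = T' ∧ x ∈ O ∧ x' ∈ O' ∧
    PiecewiseClose Γ η t t' σ rev x x'

/-- The decomposition of the original orbit into four pieces of lengths `T₁, T₂, T₃, T₄`. -/
def apiTimes (T₁ T₂ T₃ T₄ : ℝ) : Fin 5 → ℝ :=
  ![0, T₁, T₁ + T₂, T₁ + T₂ + T₃, T₁ + T₂ + T₃ + T₄]

/-- The partner runs through the pieces in the order first, third, fourth, second. -/
def apiPerm : Equiv.Perm (Fin 4) where
  toFun := ![0, 3, 1, 2]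
  invFun := ![0, 2, 3, 1]
  left_inv := by decide
  right_inv := by decide

/-- The third and the fourth piece are run backwards by the partner. -/
def apiRev : Fin 4 → Bool := ![false, false, true, true]

/-- `O'`, with period `T'`, is an `η`-partner, reconnected in both encounters, of the orbit through
`x`, which is decomposed into pieces of lengths `T₁, T₂, T₃, T₄`. The lengths of corresponding
pieces differ by less than `ε`. -/
def IsReconnectedPartner (ε η : ℝ) (x : X Γ) (T₁ T₂ T₃ T₄ : ℝ) (O' : Set (X Γ)) (T' : ℝ)
    (x' : X Γ) (t' : Fin 5 → ℝ) : Prop :=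
  IsPeriodicOrbit Γ O' T' ∧ x' ∈ O' ∧ StrictMono t' ∧ t' 0 = 0 ∧ t' 4 = T' ∧
  PiecewiseClose Γ η (apiTimes T₁ T₂ T₃ T₄) t' apiPerm apiRev x x' ∧
  ∀ j : Fin 4, |(t' (apiPerm j).succ - t' (apiPerm j).castSucc) -
    (apiTimes T₁ T₂ T₃ T₄ j.succ - apiTimes T₁ T₂ T₃ T₄ j.castSucc)| < ε

/-- In each of its four passages through the two encounters (at `x, z` and at `y, T w`), the partner
crosses the Poincaré section at a point which is not one of the two points of the original orbit
that define the encounter. -/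
def AvoidsPiercingPoints (ε : ℝ) (x y z w x' : X Γ) (t' : Fin 5 → ℝ) : Prop :=
  (∃ τ : ℝ, |τ - t' 0| < ε ∧ flow Γ τ x' ∈ poincareSection Γ (5 * ε) x \ {x, z}) ∧
  (∃ τ : ℝ, |τ - t' 1| < ε ∧ flow Γ τ x' ∈ poincareSection Γ (5 * ε) y \ {y, timeRev Γ w}) ∧
  (∃ τ : ℝ, |τ - t' 2| < ε ∧ timeRev Γ (flow Γ τ x') ∈ poincareSection Γ (5 * ε) x \ {x, z}) ∧
  (∃ τ : ℝ, |τ - t' 3| < ε ∧ flow Γ τ x' ∈ poincareSection Γ (5 * ε) y \ {y, timeRev Γ w})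

end HadamardGutzwiller

/-! Lift everything to PSL(2,ℝ). A closed orbit with the prescribed reconnection follows lifts `G₀,
…, G₄` of the encounter points: each `G` arises from the previous one by flowing along a piece of
the given orbit, possibly time-reversed, and then making a small hop `c u * b s`, or the inverse of
such a hop, across an encounter (`exists_encounterLifts`). Since `G₀` and `G₄` both lie over `x`, a
partner is a cyclic solution `vᵢ, wᵢ` of four equations saying that the flow carries `Gᵢ * (c vᵢ * b
wᵢ)` to its successor.

The first column of `c v * b w` has slope `v`; the second has inverse slope `n`, where `w = n / (1 -
v * n)`. Hops act on both by Möbius maps, and a piece of length `L` contracts by `e^{-L}`, backwards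
for `v` and forwards for `n`. The system thus decouples into two cycles of interval maps, each
having a fixed point (`exists_cycle`, `exists_unstable_slopes`, `exists_stable_slopes`). The factor
by which a hop scales the first column becomes the time correction of the piece (`hop_cb`,
`hop_bc`); the sum of these logarithms is the action difference (`abs_action_le`).

The lower bounds on `u₁` and `s₁` make three coordinates of the partner nonzero. Nothing bounds `u₂`
or `s₂` from below, so one coincidence with the old orbit, at `y`, has to be excluded otherwise: it
would provide an element of Γ conjugating a hyperbolic element to its inverse, and such an element
is elliptic of order two, against freeness (`EncounterLifts.not_conj`, `ActsFreely.not_inverted`).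

The displacement bound makes closeness of orbits persist for chosen lifts, so two close periodic
lifts have the same deck transformation and hence the same axis; this gives a coincidence constant
(`IsDisplacementBound.isCoincidenceConst`). The constructed partner is even `10ε`-close, so any
`19ε`-partner stays within `38ε` of it and coincides with it (`IsCoincidenceConst.eq_partner`). -/

namespace HadamardGutzwiller

/-! ### The left-invariant metric on PSL(2,ℝ): curves, invariance, triangle inequality. -/

/-- The Frobenius norm of a matrix. -/
noncomputable def frob (A : Matrix (Fin 2) (Fin 2) ℝ) : ℝ :=
  Real.sqrt (Matrix.trace (A.transpose * A))

/-- The speed of a curve for the left-invariant metric. -/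
noncomputable def speed (γ : ℝ → SL(2, ℝ)) (t : ℝ) : ℝ :=
  frob (((γ t)⁻¹ : SL(2, ℝ)).1 * Matrix.of fun i j => deriv (fun r => (γ r).1 i j) t)

/-- Continuously differentiable curves in `SL(2, ℝ)`. -/
def IsC1Curve (γ : ℝ → SL(2, ℝ)) : Prop := ∀ i j, ContDiff ℝ 1 fun t => (γ t).1 i j

lemma coe_aMat (t : ℝ) : (aMat t).1 = !![Real.exp (t / 2), 0; 0, Real.exp (-t / 2)] := rfl

lemma coe_bMat (s : ℝ) : (bMat s).1 = !![1, s; 0, 1] := rfl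

lemma coe_cMat (u : ℝ) : (cMat u).1 = !![1, 0; u, 1] := rfl

lemma coe_dPiMat : dPiMat.1 = !![0, 1; -1, 0] := rfl

lemma sl_mul_apply (A B : SL(2, ℝ)) (i j : Fin 2) :
    (A * B).1 i j = A.1 i 0 * B.1 0 j + A.1 i 1 * B.1 1 j := by
  rw [Matrix.SpecialLinearGroup.coe_mul, Matrix.mul_apply, Fin.sum_univ_two]

lemma sl_coe_inv (A : SL(2, ℝ)) :
    (A⁻¹ : SL(2, ℝ)).1 = !![A.1 1 1, -A.1 0 1; -A.1 1 0, A.1 0 0] := by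
  rw [Matrix.SpecialLinearGroup.SL2_inv_expl]
  rfl

lemma sl_ext {A B : SL(2, ℝ)} (h00 : A.1 0 0 = B.1 0 0) (h01 : A.1 0 1 = B.1 0 1)
    (h10 : A.1 1 0 = B.1 1 0) (h11 : A.1 1 1 = B.1 1 1) : A = B := by
  ext i j
  fin_cases i <;> fin_cases j
  exacts [h00, h01, h10, h11]

lemma curveLength_eq (γ : ℝ → SL(2, ℝ)) : curveLength γ = ∫ t in (0 : ℝ)..1, speed γ t := rfl

lemma frob_nonneg (A : Matrix (Fin 2) (Fin 2) ℝ) : 0 ≤ frob A := Real.sqrt_nonneg _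

lemma frob_eq (A : Matrix (Fin 2) (Fin 2) ℝ) :
    frob A = Real.sqrt (A 0 0 ^ 2 + A 0 1 ^ 2 + A 1 0 ^ 2 + A 1 1 ^ 2) := by
  unfold frob
  congr 1
  simp only [Matrix.trace, Matrix.diag, Matrix.mul_apply, Matrix.transpose_apply,
    Fin.sum_univ_two]
  ring

lemma frob_smul (r : ℝ) (A : Matrix (Fin 2) (Fin 2) ℝ) : frob (r • A) = |r| * frob A := by
  rw [frob_eq, frob_eq, ← Real.sqrt_sq_eq_abs, ← Real.sqrt_mul (sq_nonneg r)]
  congr 1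
  simp only [Matrix.smul_apply, smul_eq_mul]
  ring

lemma speed_nonneg (γ : ℝ → SL(2, ℝ)) (t : ℝ) : 0 ≤ speed γ t := frob_nonneg _

lemma curveLength_nonneg (γ : ℝ → SL(2, ℝ)) : 0 ≤ curveLength γ := by
  rw [curveLength_eq]
  exact intervalIntegral.integral_nonneg zero_le_one fun t _ => speed_nonneg γ t

lemma speed_of_hasDerivAt {γ : ℝ → SL(2, ℝ)} {t : ℝ} {D : Matrix (Fin 2) (Fin 2) ℝ}
    (h : ∀ i j, HasDerivAt (fun r => (γ r).1 i j) (D i j) t) :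
    speed γ t = frob (((γ t)⁻¹ : SL(2, ℝ)).1 * D) := by
  unfold speed
  congr 2
  ext i j
  exact (h i j).deriv

lemma IsC1Curve.hasDerivAt {γ : ℝ → SL(2, ℝ)} (h : IsC1Curve γ) (t : ℝ) (i j : Fin 2) :
    HasDerivAt (fun r => (γ r).1 i j)
      ((Matrix.of fun i j => deriv (fun r => (γ r).1 i j) t : Matrix (Fin 2) (Fin 2) ℝ) i j) t :=
  ((h i j).differentiable one_ne_zero t).hasDerivAt

lemma IsC1Curve.mul {γ δ : ℝ → SL(2, ℝ)} (h : IsC1Curve γ) (h' : IsC1Curve δ) :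
    IsC1Curve fun t => γ t * δ t := by
  intro i j
  simp only [Matrix.SpecialLinearGroup.coe_mul, Matrix.mul_apply]
  exact ContDiff.sum fun k _ => (h i k).mul (h' k j)

lemma isC1Curve_const (A : SL(2, ℝ)) : IsC1Curve fun _ => A := fun _ _ => contDiff_const

lemma IsC1Curve.comp {γ : ℝ → SL(2, ℝ)} (h : IsC1Curve γ) {φ : ℝ → ℝ} (hφ : ContDiff ℝ 1 φ) :
    IsC1Curve fun t => γ (φ t) := fun i j => (h i j).comp hφ

lemma IsC1Curve.continuous_speed {γ : ℝ → SL(2, ℝ)} (h : IsC1Curve γ) : Continuous (speed γ) := by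
  have h0 : ∀ i j, Continuous fun t => (γ t).1 i j := fun i j => (h i j).continuous
  have h1 : ∀ i j, Continuous fun t => deriv (fun r => (γ r).1 i j) t := fun i j =>
    (h i j).continuous_deriv le_rfl
  have h2 : ∀ i j, Continuous fun t => ((γ t)⁻¹ : SL(2, ℝ)).1 i j := by
    intro i j
    simp only [sl_coe_inv]
    fin_cases i <;> fin_cases j
    exacts [h0 _ _, (h0 _ _).neg, (h0 _ _).neg, h0 _ _]
  have h3 : ∀ i j, Continuous fun t => (((γ t)⁻¹ : SL(2, ℝ)).1 *
      Matrix.of fun i j => deriv (fun r => (γ r).1 i j) t) i j := by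
    intro i j
    simp only [Matrix.mul_apply, Fin.sum_univ_two]
    exact ((h2 i 0).mul (h1 0 j)).add ((h2 i 1).mul (h1 1 j))
  unfold speed
  simp only [frob_eq]
  exact Real.continuous_sqrt.comp (((((h3 0 0).pow 2).add ((h3 0 1).pow 2)).add
    ((h3 1 0).pow 2)).add ((h3 1 1).pow 2))

lemma speed_congr {γ δ : ℝ → SL(2, ℝ)} {t : ℝ} (h : γ =ᶠ[nhds t] δ) : speed γ t = speed δ t := by
  unfold speed
  rw [h.eq_of_nhds]
  congr 2
  ext i j
  exact Filter.EventuallyEq.deriv_eq (h.mono fun r hr => by simp only [hr])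

lemma speed_mul_left (A : SL(2, ℝ)) {γ : ℝ → SL(2, ℝ)} (h : IsC1Curve γ) (t : ℝ) :
    speed (fun r => A * γ r) t = speed γ t := by
  rw [speed_of_hasDerivAt (h.hasDerivAt t), speed_of_hasDerivAt
    (D := A.1 * Matrix.of fun i j => deriv (fun r => (γ r).1 i j) t)]
  · rw [← mul_assoc, ← Matrix.SpecialLinearGroup.coe_mul]
    congr 2
    group
  · intro i j
    simp only [Matrix.SpecialLinearGroup.coe_mul, Matrix.mul_apply]
    exact HasDerivAt.fun_sum fun k _ => (h.hasDerivAt t k j).const_mul _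

lemma speed_mul_right (B : SL(2, ℝ)) {γ : ℝ → SL(2, ℝ)} (h : IsC1Curve γ)
    (hB : ∀ Y, frob ((B⁻¹ : SL(2, ℝ)).1 * Y * B.1) = frob Y) (t : ℝ) :
    speed (fun r => γ r * B) t = speed γ t := by
  rw [speed_of_hasDerivAt (h.hasDerivAt t), speed_of_hasDerivAt
    (D := (Matrix.of fun i j => deriv (fun r => (γ r).1 i j) t) * B.1)]
  · rw [mul_inv_rev, Matrix.SpecialLinearGroup.coe_mul]
    conv_rhs => rw [← hB]
    simp only [mul_assoc]
  · intro i j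
    simp only [Matrix.SpecialLinearGroup.coe_mul, Matrix.mul_apply]
    exact HasDerivAt.fun_sum fun k _ => (h.hasDerivAt t i k).mul_const _

lemma speed_comp {γ : ℝ → SL(2, ℝ)} (h : IsC1Curve γ) {φ : ℝ → ℝ} {φ' t : ℝ}
    (hφ : HasDerivAt φ φ' t) : speed (fun r => γ (φ r)) t = |φ'| * speed γ (φ t) := by
  rw [speed_of_hasDerivAt (h.hasDerivAt (φ t)), ← frob_smul, speed_of_hasDerivAt
    (D := φ' • Matrix.of fun i j => deriv (fun r => (γ r).1 i j) (φ t))]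
  · rw [Matrix.mul_smul]
  · intro i j
    have := (h.hasDerivAt (φ t) i j).comp t hφ
    rwa [Matrix.smul_apply, smul_eq_mul, mul_comm]

lemma integral_speed_comp {γ : ℝ → SL(2, ℝ)} (h : IsC1Curve γ) {φ : ℝ → ℝ}
    (hφ : ContDiff ℝ 1 φ) (hm : Monotone φ) (p q : ℝ) :
    ∫ t in p..q, speed (fun r => γ (φ r)) t = ∫ t in φ p..φ q, speed γ t := by
  have hd : ∀ x, HasDerivAt φ (deriv φ x) x := fun x =>
    (hφ.differentiable one_ne_zero x).hasDerivAt
  rw [← intervalIntegral.integral_comp_mul_deriv (fun x _ => hd x)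
    (hφ.continuous_deriv le_rfl).continuousOn h.continuous_speed]
  refine intervalIntegral.integral_congr fun t _ => ?_
  simp only [Function.comp]
  rw [speed_comp h (hd t), abs_of_nonneg hm.deriv_nonneg, mul_comm]

lemma curveLength_mul_left (A : SL(2, ℝ)) {γ : ℝ → SL(2, ℝ)} (h : IsC1Curve γ) :
    curveLength (fun r => A * γ r) = curveLength γ := by
  simp only [curveLength_eq, speed_mul_left A h]

lemma curveLength_reverse {γ : ℝ → SL(2, ℝ)} (h : IsC1Curve γ) :
    curveLength (fun r => γ (1 - r)) = curveLength γ := by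
  have h1 : ∀ t : ℝ, speed (fun r => γ (1 - r)) t = speed γ (1 - t) := fun t => by
    rw [speed_comp h ((hasDerivAt_id' t).const_sub 1)]
    simp
  simp only [curveLength_eq, h1]
  rw [intervalIntegral.integral_comp_sub_left (fun t => speed γ t) 1]
  simp

lemma exists_concat {γ δ : ℝ → SL(2, ℝ)} (h : IsC1Curve γ) (h' : IsC1Curve δ)
    (hγδ : γ 1 = δ 0) : ∃ η : ℝ → SL(2, ℝ), IsC1Curve η ∧ η 0 = γ 0 ∧ η 1 = δ 1 ∧
      curveLength η = curveLength γ + curveLength δ := by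
  have hs1 : ContDiff ℝ 1 fun t : ℝ => Real.smoothTransition (3 * t) :=
    Real.smoothTransition.contDiff.comp (contDiff_const.mul contDiff_id)
  have hs2 : ContDiff ℝ 1 fun t : ℝ => Real.smoothTransition (3 * t - 2) :=
    Real.smoothTransition.contDiff.comp ((contDiff_const.mul contDiff_id).sub contDiff_const)
  have hm1 : Monotone fun t : ℝ => Real.smoothTransition (3 * t) := fun p q hpq =>
    Real.smoothTransition.monotone (by linarith)
  have hm2 : Monotone fun t : ℝ => Real.smoothTransition (3 * t - 2) := fun p q hpq =>
    Real.smoothTransition.monotone (by linarith)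
  -- A product in the group replaces gluing: the first factor is constant from time 1/3 on, the
  -- second up to time 2/3, so the curve rests in between and is C¹ without any matching of
  -- derivatives.
  let η : ℝ → SL(2, ℝ) := fun t => γ (Real.smoothTransition (3 * t)) *
    ((γ 1)⁻¹ * δ (Real.smoothTransition (3 * t - 2)))
  have hC : IsC1Curve η := (h.comp hs1).mul ((isC1Curve_const _).mul (h'.comp hs2))
  have e1 : ∀ t : ℝ, t ≤ 2 / 3 → η t = γ (Real.smoothTransition (3 * t)) := fun t ht => by
    simp only [η]
    rw [Real.smoothTransition.zero_of_nonpos (x := 3 * t - 2) (by linarith), hγδ]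
    group
  have e2 : ∀ t : ℝ, 1 / 3 ≤ t → η t = δ (Real.smoothTransition (3 * t - 2)) := fun t ht => by
    simp only [η]
    rw [Real.smoothTransition.one_of_one_le (x := 3 * t) (by linarith)]
    group
  refine ⟨η, hC, ?_, ?_, ?_⟩
  · rw [e1 0 (by norm_num)]; simp
  · rw [e2 1 (by norm_num)]; norm_num
  · have c := hC.continuous_speed
    rw [curveLength_eq, ← intervalIntegral.integral_add_adjacent_intervals
      (c.intervalIntegrable 0 (1 / 2)) (c.intervalIntegrable (1 / 2) 1)]
    refine congrArg₂ (· + ·) ?_ ?_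
    · trans ∫ t in (0 : ℝ)..(1 / 2), speed (fun r => γ (Real.smoothTransition (3 * r))) t
      · refine intervalIntegral.integral_congr fun t ht => ?_
        rw [Set.uIcc_of_le (by norm_num)] at ht
        apply speed_congr
        filter_upwards [Iio_mem_nhds (show t < 2 / 3 by linarith [ht.2])] with r hr
        exact e1 r (le_of_lt hr)
      · rw [integral_speed_comp h hs1 hm1, curveLength_eq]
        rw [Real.smoothTransition.zero_of_nonpos (by norm_num),
          Real.smoothTransition.one_of_one_le (by norm_num)]
    · trans ∫ t in (1 / 2 : ℝ)..1, speed (fun r => δ (Real.smoothTransition (3 * r - 2))) t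
      · refine intervalIntegral.integral_congr fun t ht => ?_
        rw [Set.uIcc_of_le (by norm_num)] at ht
        apply speed_congr
        filter_upwards [Ioi_mem_nhds (show 1 / 3 < t by linarith [ht.1])] with r hr
        exact e2 r (le_of_lt hr)
      · rw [integral_speed_comp h' hs2 hm2, curveLength_eq]
        rw [Real.smoothTransition.zero_of_nonpos (by norm_num),
          Real.smoothTransition.one_of_one_le (by norm_num)]

lemma mk_surj (g : PSL2R) : ∃ A : SL(2, ℝ), (A : PSL2R) = g := QuotientGroup.mk_surjective g

lemma mk_mul (A B : SL(2, ℝ)) : ((A * B : SL(2, ℝ)) : PSL2R) = (A : PSL2R) * (B : PSL2R) := rfl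

lemma bddBelow_lengths (g h : PSL2R) :
    BddBelow {l : ℝ | ∃ γ : ℝ → SL(2, ℝ), (∀ i j, ContDiff ℝ 1 fun t => (γ t).1 i j) ∧
    (γ 0 : PSL2R) = g ∧ (γ 1 : PSL2R) = h ∧ l = curveLength γ} :=
  ⟨0, by rintro l ⟨γ, -, -, -, rfl⟩; exact curveLength_nonneg γ⟩

lemma dG_le_curveLength {γ : ℝ → SL(2, ℝ)} (hγ : IsC1Curve γ) {g h : PSL2R}
    (h0 : (γ 0 : PSL2R) = g) (h1 : (γ 1 : PSL2R) = h) : dG g h ≤ curveLength γ :=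
  csInf_le (bddBelow_lengths g h) ⟨γ, hγ, h0, h1, rfl⟩

lemma dG_nonneg (g h : PSL2R) : 0 ≤ dG g h :=
  Real.sInf_nonneg (by rintro l ⟨γ, -, -, -, rfl⟩; exact curveLength_nonneg γ)

lemma isC1Curve_bMat (s : ℝ) : IsC1Curve fun t => bMat (s * t) := by
  intro i j
  fin_cases i <;> fin_cases j <;> simp [bMat] <;> fun_prop

lemma isC1Curve_cMat (u : ℝ) : IsC1Curve fun t => cMat (u * t) := by
  intro i j
  fin_cases i <;> fin_cases j <;> simp [cMat] <;> fun_prop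

lemma isC1Curve_aMat (τ : ℝ) : IsC1Curve fun t => aMat (τ * t) := by
  intro i j
  fin_cases i <;> fin_cases j <;> simp [aMat] <;> fun_prop

lemma bMat_zero : bMat 0 = 1 := by
  ext i j; fin_cases i <;> fin_cases j <;> simp [bMat]

lemma cMat_zero : cMat 0 = 1 := by
  ext i j; fin_cases i <;> fin_cases j <;> simp [cMat]

lemma aMat_zero : aMat 0 = 1 := by
  ext i j; fin_cases i <;> fin_cases j <;> simp [aMat]

/-- Every element of `SL(2, ℝ)` is a product of four unipotent ones. -/
lemma exists_eq_unipotents (A : SL(2, ℝ)) : ∃ p q r s : ℝ,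
    A = bMat p * cMat q * bMat r * cMat s := by
  have key : ∀ B : SL(2, ℝ), B.1 1 0 ≠ 0 → ∃ p q r : ℝ, B = bMat p * cMat q * bMat r := by
    intro B hB
    have hd := B.2
    rw [Matrix.det_fin_two] at hd
    refine ⟨(B.1 0 0 - 1) / B.1 1 0, B.1 1 0, (B.1 1 1 - 1) / B.1 1 0, ?_⟩
    apply sl_ext <;> simp [coe_bMat, coe_cMat, sl_mul_apply] <;> field_simp <;>
      first | ring1 | linear_combination hd | linear_combination -hd
  by_cases h : A.1 1 0 = 0
  -- If the lower left entry vanishes, the lower right one does not, and `cMat 1` adds it to the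
  -- lower left place.
  · obtain ⟨p, q, r, e⟩ := key (A * cMat 1) (by
      have hd := A.2
      rw [Matrix.det_fin_two, h] at hd
      rw [sl_mul_apply, coe_cMat]
      simp only [Matrix.of_apply, Matrix.cons_val', Matrix.cons_val_zero, Matrix.cons_val_one,
        Matrix.cons_val_fin_one, h]
      intro h0
      simp at h0
      simp [h0] at hd)
    refine ⟨p, q, r, -1, ?_⟩
    rw [← e, mul_assoc]
    have : cMat 1 * cMat (-1) = 1 := by
      apply sl_ext <;> simp [coe_cMat, sl_mul_apply]
    rw [this, mul_one]
  · obtain ⟨p, q, r, e⟩ := key A h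
    exact ⟨p, q, r, 0, by rw [cMat_zero, mul_one, e]⟩

/-- The infimum of the empty set of reals is 0, so near-minimal curves exist only because any two
points are joined by some curve; a product of unipotent one-parameter curves does this. -/
lemma nonempty_lengths (g h : PSL2R) :
    {l : ℝ | ∃ γ : ℝ → SL(2, ℝ), (∀ i j, ContDiff ℝ 1 fun t => (γ t).1 i j) ∧
    (γ 0 : PSL2R) = g ∧ (γ 1 : PSL2R) = h ∧ l = curveLength γ}.Nonempty := by
  obtain ⟨A, rfl⟩ := mk_surj g
  obtain ⟨B, rfl⟩ := mk_surj h
  obtain ⟨p, q, r, s, e⟩ := exists_eq_unipotents (A⁻¹ * B)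
  refine ⟨_, fun t => A * (bMat (p * t) * cMat (q * t) * bMat (r * t) * cMat (s * t)),
    (isC1Curve_const A).mul ((((isC1Curve_bMat p).mul (isC1Curve_cMat q)).mul
      (isC1Curve_bMat r)).mul (isC1Curve_cMat s)), ?_, ?_, rfl⟩
  · simp [bMat_zero, cMat_zero]
  · simp [← e]

lemma exists_curve_lt {g h : PSL2R} {r : ℝ} (hr : dG g h < r) :
    ∃ γ : ℝ → SL(2, ℝ), IsC1Curve γ ∧ (γ 0 : PSL2R) = g ∧ (γ 1 : PSL2R) = h ∧
      curveLength γ < r := by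
  obtain ⟨l, ⟨γ, hγ, h0, h1, rfl⟩, hl⟩ := exists_lt_of_csInf_lt (nonempty_lengths g h) hr
  exact ⟨γ, hγ, h0, h1, hl⟩

lemma dG_mul_left_le (k g h : PSL2R) : dG (k * g) (k * h) ≤ dG g h := by
  refine le_of_forall_gt fun r hr => ?_
  obtain ⟨γ, hγ, h0, h1, hl⟩ := exists_curve_lt hr
  obtain ⟨A, rfl⟩ := mk_surj k
  refine (dG_le_curveLength ((isC1Curve_const A).mul hγ) ?_ ?_).trans_lt
    ((curveLength_mul_left A hγ).trans_lt hl)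
  · rw [mk_mul, h0]
  · rw [mk_mul, h1]

lemma dG_mul_left (k g h : PSL2R) : dG (k * g) (k * h) = dG g h := by
  refine le_antisymm (dG_mul_left_le k g h) ?_
  simpa using dG_mul_left_le k⁻¹ (k * g) (k * h)

lemma dG_comm_le (g h : PSL2R) : dG g h ≤ dG h g := by
  refine le_of_forall_gt fun r hr => ?_
  obtain ⟨γ, hγ, h0, h1, hl⟩ := exists_curve_lt hr
  refine (dG_le_curveLength (hγ.comp (φ := fun r => 1 - r) (by fun_prop)) ?_ ?_).trans_lt
    ((curveLength_reverse hγ).trans_lt hl)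
  · simpa using h1
  · simpa using h0

lemma dG_comm (g h : PSL2R) : dG g h = dG h g :=
  le_antisymm (dG_comm_le g h) (dG_comm_le h g)

lemma dG_triangle (g h k : PSL2R) : dG g k ≤ dG g h + dG h k := by
  refine le_of_forall_pos_lt_add fun e he => ?_
  obtain ⟨γ, hγ, h0, h1, hl⟩ := exists_curve_lt (show dG g h < dG g h + e / 2 by linarith)
  obtain ⟨δ, hδ, k0, k1, kl⟩ := exists_curve_lt (show dG h k < dG h k + e / 2 by linarith)
  -- The two lifts of `h` to SL(2,ℝ) may differ by a sign; left multiplication by this central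
  -- element makes the curves meet without changing lengths.
  have hB : ((γ 1 * (δ 0)⁻¹ : SL(2, ℝ)) : PSL2R) = 1 := by
    have : ((γ 1 * (δ 0)⁻¹ : SL(2, ℝ)) : PSL2R) = (γ 1 : PSL2R) * (δ 0 : PSL2R)⁻¹ := rfl
    rw [this, h1, k0, mul_inv_cancel]
  obtain ⟨η, hη, e0, e1, el⟩ := exists_concat hγ
    ((isC1Curve_const (γ 1 * (δ 0)⁻¹)).mul hδ) (by group)
  have := dG_le_curveLength hη (g := g) (h := k) (by rw [e0, h0])
    (by rw [e1, mk_mul, hB, one_mul, k1])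
  rw [el, curveLength_mul_left _ hδ] at this
  linarith

/-- The matrix is orthogonal, so conjugation preserves the norm; therefore right multiplication by
it, the time reversal, is an isometry. -/
lemma frob_conj_dPiMat (Y : Matrix (Fin 2) (Fin 2) ℝ) :
    frob ((dPiMat⁻¹ : SL(2, ℝ)).1 * Y * dPiMat.1) = frob Y := by
  rw [frob_eq, frob_eq, sl_coe_inv]
  congr 1
  simp [coe_dPiMat, Matrix.vecMul, Matrix.vecHead, Matrix.vecTail, Matrix.mul_apply, Fin.sum_univ_two]
  ring

lemma dPi_mul_dPi : dPi * dPi = 1 := by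
  unfold dPi
  change ((dPiMat * dPiMat : SL(2, ℝ)) : PSL2R) = 1
  rw [QuotientGroup.eq_one_iff, Matrix.SpecialLinearGroup.mem_center_iff]
  refine ⟨-1, by simp, ?_⟩
  ext i j
  fin_cases i <;> fin_cases j <;> simp [coe_dPiMat, sl_mul_apply]

lemma dG_mul_dPi_le (g h : PSL2R) : dG (g * dPi) (h * dPi) ≤ dG g h := by
  refine le_of_forall_gt fun r hr => ?_
  obtain ⟨γ, hγ, h0, h1, hl⟩ := exists_curve_lt hr
  refine (dG_le_curveLength (hγ.mul (isC1Curve_const dPiMat)) ?_ ?_).trans_lt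
    ((?_ : _ = _).trans_lt hl)
  · rw [mk_mul, h0]; rfl
  · rw [mk_mul, h1]; rfl
  · simp only [curveLength_eq, speed_mul_right dPiMat hγ frob_conj_dPiMat]

lemma dG_mul_dPi (g h : PSL2R) : dG (g * dPi) (h * dPi) = dG g h := by
  refine le_antisymm (dG_mul_dPi_le g h) ?_
  simpa [mul_assoc, dPi_mul_dPi] using dG_mul_dPi_le (g * dPi) (h * dPi)

lemma dG_one_le_of_speed {γ : ℝ → SL(2, ℝ)} (hγ : IsC1Curve γ) (h0 : γ 0 = 1) {r : ℝ}
    (hs : ∀ t, speed γ t = r) (g : PSL2R) : dG g (g * (γ 1 : PSL2R)) ≤ r := by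
  rw [← dG_mul_left g⁻¹]
  simp only [inv_mul_cancel, inv_mul_cancel_left]
  refine (dG_le_curveLength hγ (by rw [h0]; rfl) rfl).trans_eq ?_
  simp [curveLength_eq, hs]

lemma dG_mul_b (g : PSL2R) (s : ℝ) : dG g (g * b s) ≤ |s| := by
  have := dG_one_le_of_speed (isC1Curve_bMat s) (by rw [mul_zero, bMat_zero]) (r := |s|) ?_ g
  · simpa using! this
  intro t
  rw [speed_of_hasDerivAt (D := !![0, s; 0, 0])]
  · rw [frob_eq, sl_coe_inv, ← Real.sqrt_sq_eq_abs]
    congr 1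
    simp [coe_bMat, Matrix.mul_apply, Fin.sum_univ_two]
  · intro i j
    fin_cases i <;> fin_cases j <;> simp [bMat] <;> first | exact hasDerivAt_const _ _ | skip
    simpa using (hasDerivAt_id t).const_mul s

lemma dG_mul_c (g : PSL2R) (u : ℝ) : dG g (g * c u) ≤ |u| := by
  have := dG_one_le_of_speed (isC1Curve_cMat u) (by rw [mul_zero, cMat_zero]) (r := |u|) ?_ g
  · simpa using! this
  intro t
  rw [speed_of_hasDerivAt (D := !![0, 0; u, 0])]
  · rw [frob_eq, sl_coe_inv, ← Real.sqrt_sq_eq_abs]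
    congr 1
    simp [coe_cMat, Matrix.mul_apply, Fin.sum_univ_two]
  · intro i j
    fin_cases i <;> fin_cases j <;> simp [cMat] <;> first | exact hasDerivAt_const _ _ | skip
    simpa using (hasDerivAt_id t).const_mul u

lemma dG_mul_a (g : PSL2R) (τ : ℝ) : dG g (g * a τ) ≤ |τ| / Real.sqrt 2 := by
  have := dG_one_le_of_speed (isC1Curve_aMat τ) (by rw [mul_zero, aMat_zero])
    (r := |τ| / Real.sqrt 2) ?_ g
  · simpa using! this
  intro t
  have e : ∀ x : ℝ, Real.exp x * Real.exp (-x) = 1 := fun x => by rw [← Real.exp_add]; simp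
  rw [speed_of_hasDerivAt (D := !![Real.exp (τ * t / 2) * (τ / 2), 0; 0,
    Real.exp (-(τ * t) / 2) * (-τ / 2)])]
  · rw [frob_eq, sl_coe_inv, ← Real.sqrt_sq_eq_abs,
      ← Real.sqrt_div (sq_nonneg τ)]
    congr 1
    have e1 := e (τ * t / 2)
    simp only [coe_aMat, neg_div]
    simp [Matrix.mul_apply, Fin.sum_univ_two]
    rw [← mul_assoc, ← mul_assoc, mul_comm (Real.exp (-(τ * t / 2))), e1]
    ring
  · intro i j
    fin_cases i <;> fin_cases j <;> simp [aMat] <;> first | exact hasDerivAt_const _ _ | skip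
    · have := (((hasDerivAt_id t).const_mul τ).div_const 2).exp
      simpa using this
    · have := ((((hasDerivAt_id t).const_mul τ).neg).div_const 2).exp
      simpa using this

lemma dG_mul_cb (g : PSL2R) (u s : ℝ) : dG g (g * c u * b s) ≤ |u| + |s| :=
  (dG_triangle g (g * c u) _).trans (add_le_add (dG_mul_c g u) (dG_mul_b _ s))

end HadamardGutzwiller

/-! ### Commutation relations, and flow, time reversal and distance on the quotient. -/

namespace HadamardGutzwiller

lemma a_add (s t : ℝ) : a (s + t) = a s * a t := by
  unfold a
  rw [← mk_mul]
  congr 1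
  apply sl_ext <;> simp [coe_aMat, sl_mul_apply, ← Real.exp_add] <;> ring_nf

lemma a_zero : a 0 = 1 := by
  unfold a
  rw [aMat_zero]
  rfl

lemma a_neg (t : ℝ) : a (-t) = (a t)⁻¹ :=
  eq_inv_of_mul_eq_one_left (by rw [← a_add, neg_add_cancel, a_zero])

lemma b_zero : b 0 = 1 := by
  unfold b
  rw [bMat_zero]
  rfl

lemma c_zero : c 0 = 1 := by
  unfold c
  rw [cMat_zero]
  rfl

lemma b_add (s t : ℝ) : b (s + t) = b s * b t := by
  unfold b
  rw [← mk_mul]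
  congr 1
  apply sl_ext <;> simp [coe_bMat, sl_mul_apply, add_comm]

lemma c_add (s t : ℝ) : c (s + t) = c s * c t := by
  unfold c
  rw [← mk_mul]
  congr 1
  apply sl_ext <;> simp [coe_cMat, sl_mul_apply]

lemma b_neg (t : ℝ) : b (-t) = (b t)⁻¹ :=
  eq_inv_of_mul_eq_one_left (by rw [← b_add, neg_add_cancel, b_zero])

lemma c_neg (t : ℝ) : c (-t) = (c t)⁻¹ :=
  eq_inv_of_mul_eq_one_left (by rw [← c_add, neg_add_cancel, c_zero])

/-- The centre consists of the scalars of square 1; this turns identities in PSL(2,ℝ) into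
identities of entries up to sign. -/
lemma mk_eq_mk {A B : SL(2, ℝ)} (h : (A : PSL2R) = (B : PSL2R)) :
    ∃ r : ℝ, (r = 1 ∨ r = -1) ∧ ∀ i j, B.1 i j = r * A.1 i j := by
  rw [QuotientGroup.eq, Matrix.SpecialLinearGroup.mem_center_iff] at h
  obtain ⟨r, hr, h⟩ := h
  have h2 : r * r = 1 := by simpa [pow_two] using hr
  refine ⟨r, mul_self_eq_one_iff.mp h2, fun i j => ?_⟩
  have e : B.1 = A.1 * (A⁻¹ * B : SL(2, ℝ)).1 := by
    rw [← Matrix.SpecialLinearGroup.coe_mul, mul_inv_cancel_left]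
  rw [e, ← h]
  simp [mul_comm]

lemma mk_eq_of_neg {A B : SL(2, ℝ)} (h : ∀ i j, B.1 i j = -A.1 i j) :
    (A : PSL2R) = (B : PSL2R) := by
  rw [QuotientGroup.eq, Matrix.SpecialLinearGroup.mem_center_iff]
  refine ⟨-1, by simp, ?_⟩
  have e : B.1 = -A.1 := by
    ext i j
    rw [Matrix.neg_apply, h]
  rw [Matrix.SpecialLinearGroup.coe_mul, e, mul_neg, ← Matrix.SpecialLinearGroup.coe_mul,
    inv_mul_cancel]
  ext i j
  fin_cases i <;> fin_cases j <;> simp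

lemma a_mul_dPi (t : ℝ) : a t * dPi = dPi * a (-t) := by
  unfold a dPi
  rw [← mk_mul, ← mk_mul]
  congr 1
  apply sl_ext <;> simp [coe_aMat, coe_dPiMat, sl_mul_apply]

/-- With `b_mul_a`, this is the hyperbolicity of the flow: `c`-offsets expand and `b`-offsets
contract. -/
lemma c_mul_a (u t : ℝ) : c u * a t = a t * c (u * Real.exp t) := by
  unfold a c
  rw [← mk_mul, ← mk_mul]
  congr 1
  apply sl_ext <;> simp [coe_aMat, coe_cMat, sl_mul_apply]
  rw [mul_left_comm, ← Real.exp_add]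
  ring_nf

lemma b_mul_a (s t : ℝ) : b s * a t = a t * b (s * Real.exp (-t)) := by
  unfold a b
  rw [← mk_mul, ← mk_mul]
  congr 1
  apply sl_ext <;> simp [coe_aMat, coe_bMat, sl_mul_apply]
  rw [mul_left_comm, ← Real.exp_add]
  ring_nf

/-- Time reversal exchanges the stable and unstable directions. -/
lemma c_mul_dPi (u : ℝ) : c u * dPi = dPi * b (-u) := by
  unfold c b dPi
  rw [← mk_mul, ← mk_mul]
  congr 1
  apply sl_ext <;> simp [coe_bMat, coe_cMat, coe_dPiMat, sl_mul_apply]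

lemma b_mul_dPi (s : ℝ) : b s * dPi = dPi * c (-s) := by
  unfold c b dPi
  rw [← mk_mul, ← mk_mul]
  congr 1
  apply sl_ext <;> simp [coe_bMat, coe_cMat, coe_dPiMat, sl_mul_apply]

variable (Γ : Subgroup PSL2R)

lemma proj_eq_iff (g h : PSL2R) : proj Γ g = proj Γ h ↔ ∃ γ ∈ Γ, γ * g = h := by
  unfold proj
  rw [Quotient.eq, QuotientGroup.rightRel_apply]
  constructor
  · exact fun H => ⟨_, H, by group⟩
  · rintro ⟨γ, hγ, rfl⟩
    simpa using hγ

lemma proj_mul_left {γ : PSL2R} (hγ : γ ∈ Γ) (g : PSL2R) : proj Γ (γ * g) = proj Γ g :=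
  ((proj_eq_iff Γ _ _).mpr ⟨γ, hγ, rfl⟩).symm

lemma proj_surj (x : X Γ) : ∃ g, proj Γ g = x := Quotient.exists_rep x

lemma proj_mul_right {g h : PSL2R} (k : PSL2R) (H : proj Γ g = proj Γ h) :
    proj Γ (g * k) = proj Γ (h * k) := by
  obtain ⟨γ, hγ, rfl⟩ := (proj_eq_iff Γ _ _).mp H
  rw [mul_assoc, proj_mul_left Γ hγ]

lemma flow_proj (t : ℝ) (g : PSL2R) : flow Γ t (proj Γ g) = proj Γ (g * a t) := rfl

lemma timeRev_proj (g : PSL2R) : timeRev Γ (proj Γ g) = proj Γ (g * dPi) := rfl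

lemma flow_flow (s t : ℝ) (x : X Γ) : flow Γ s (flow Γ t x) = flow Γ (t + s) x := by
  obtain ⟨g, rfl⟩ := proj_surj Γ x
  simp only [flow_proj, a_add, mul_assoc]

lemma flow_zero (x : X Γ) : flow Γ 0 x = x := by
  obtain ⟨g, rfl⟩ := proj_surj Γ x
  rw [flow_proj, a_zero, mul_one]

lemma timeRev_timeRev (x : X Γ) : timeRev Γ (timeRev Γ x) = x := by
  obtain ⟨g, rfl⟩ := proj_surj Γ x
  rw [timeRev_proj, timeRev_proj, mul_assoc, dPi_mul_dPi, mul_one]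

lemma timeRev_flow (t : ℝ) (x : X Γ) : timeRev Γ (flow Γ t x) = flow Γ (-t) (timeRev Γ x) := by
  obtain ⟨g, rfl⟩ := proj_surj Γ x
  rw [flow_proj, timeRev_proj, timeRev_proj, flow_proj, mul_assoc, a_mul_dPi, mul_assoc]

lemma dX_le_dG (g h : PSL2R) : dX Γ (proj Γ g) (proj Γ h) ≤ dG g h :=
  csInf_le ⟨0, by rintro l ⟨g, h, -, -, rfl⟩; exact dG_nonneg g h⟩ ⟨g, h, rfl, rfl, rfl⟩

lemma exists_lift_of_dX_lt {g h : PSL2R} {r : ℝ} (H : dX Γ (proj Γ g) (proj Γ h) < r) :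
    ∃ γ ∈ Γ, dG g (γ * h) < r := by
  obtain ⟨l, ⟨g', h', hg, hh, rfl⟩, hl⟩ := exists_lt_of_csInf_lt
    (show {r : ℝ | ∃ g' h' : PSL2R, proj Γ g' = proj Γ g ∧ proj Γ h' = proj Γ h ∧
      r = dG g' h'}.Nonempty from ⟨_, g, h, rfl, rfl, rfl⟩) H
  obtain ⟨γ, hγ, rfl⟩ := (proj_eq_iff Γ _ _).mp hg
  obtain ⟨δ, hδ, rfl⟩ := (proj_eq_iff Γ _ _).mp hh
  refine ⟨γ * δ⁻¹, Γ.mul_mem hγ (Γ.inv_mem hδ), ?_⟩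
  have e : γ * δ⁻¹ * (δ * h') = γ * h' := by group
  rwa [e, dG_mul_left]

lemma dX_comm (x y : X Γ) : dX Γ x y = dX Γ y x := by
  have key : ∀ x y, dX Γ x y ≤ dX Γ y x := fun x y => by
    obtain ⟨g, rfl⟩ := proj_surj Γ x
    obtain ⟨h, rfl⟩ := proj_surj Γ y
    refine le_of_forall_gt fun r hr => ?_
    obtain ⟨γ, hγ, H⟩ := exists_lift_of_dX_lt Γ hr
    rw [dG_comm] at H
    rw [← proj_mul_left Γ hγ]
    exact (dX_le_dG Γ _ _).trans_lt H
  exact le_antisymm (key x y) (key y x)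

lemma dX_triangle (x y z : X Γ) : dX Γ x z ≤ dX Γ x y + dX Γ y z := by
  obtain ⟨g, rfl⟩ := proj_surj Γ x
  obtain ⟨h, rfl⟩ := proj_surj Γ y
  obtain ⟨k, rfl⟩ := proj_surj Γ z
  refine le_of_forall_pos_lt_add fun e he => ?_
  obtain ⟨γ, hγ, H1⟩ := exists_lift_of_dX_lt Γ
    (show dX Γ (proj Γ g) (proj Γ h) < dX Γ (proj Γ g) (proj Γ h) + e / 2 by linarith)
  obtain ⟨δ, hδ, H2⟩ := exists_lift_of_dX_lt Γ
    (show dX Γ (proj Γ h) (proj Γ k) < dX Γ (proj Γ h) (proj Γ k) + e / 2 by linarith)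
  have h1 := dG_triangle g (γ * h) (γ * (δ * k))
  rw [dG_mul_left] at h1
  have h2 := dX_le_dG Γ g (γ * (δ * k))
  rw [proj_mul_left Γ hγ, proj_mul_left Γ hδ] at h2
  linarith

lemma dX_timeRev_le (x y : X Γ) : dX Γ (timeRev Γ x) (timeRev Γ y) ≤ dX Γ x y := by
  obtain ⟨g, rfl⟩ := proj_surj Γ x
  obtain ⟨h, rfl⟩ := proj_surj Γ y
  refine le_of_forall_gt fun r hr => ?_
  obtain ⟨γ, hγ, H⟩ := exists_lift_of_dX_lt Γ hr
  have := dX_le_dG Γ (g * dPi) (γ * h * dPi)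
  rw [dG_mul_dPi, mul_assoc, proj_mul_left Γ hγ] at this
  exact this.trans_lt H

lemma dX_timeRev (x y : X Γ) : dX Γ (timeRev Γ x) (timeRev Γ y) = dX Γ x y := by
  refine le_antisymm (dX_timeRev_le Γ x y) ?_
  simpa [timeRev_timeRev] using dX_timeRev_le Γ (timeRev Γ x) (timeRev Γ y)

lemma dG_mul_a_mul_a (g : PSL2R) (s t : ℝ) : dG (g * a s) (g * a t) ≤ |s - t| / Real.sqrt 2 := by
  have := dG_mul_a (g * a s) (t - s)
  rwa [mul_assoc, ← a_add, add_sub_cancel, abs_sub_comm] at this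

lemma dX_flow_flow (s t : ℝ) (x : X Γ) :
    dX Γ (flow Γ s x) (flow Γ t x) ≤ |s - t| / Real.sqrt 2 := by
  obtain ⟨g, rfl⟩ := proj_surj Γ x
  exact (dX_le_dG Γ _ _).trans (dG_mul_a_mul_a g s t)

/-! ### The displacement bound and the coincidence constant. -/

variable {Γ}

lemma IsDisplacementBound.eq_one {σ₀ : ℝ} (hσ : IsDisplacementBound Γ σ₀) {γ : PSL2R}
    (hγ : γ ∈ Γ) {g : PSL2R} (h : dG g (γ * g) ≤ σ₀) : γ = 1 := by
  by_contra h1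
  have := hσ.2 γ hγ h1 g
  rw [dG_comm] at this
  linarith

lemma IsDisplacementBound.proj_injOn {σ₀ : ℝ} (hσ : IsDisplacementBound Γ σ₀) {g h : PSL2R}
    (hd : dG g h ≤ σ₀) (hp : proj Γ g = proj Γ h) : g = h := by
  obtain ⟨γ, hγ, rfl⟩ := (proj_eq_iff Γ _ _).mp hp
  rw [hσ.eq_one hγ hd, one_mul]

/-- At each time some deck transformation realises closeness; continuity in small time steps forces
it to remain the identity. -/
lemma IsDisplacementBound.lift_persists {σ₀ : ℝ} (hσ : IsDisplacementBound Γ σ₀) {g h : PSL2R}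
    {δ τ : ℝ} (hδ : 2 * δ < σ₀) (h0 : dG g h < δ)
    (hX : ∀ t ∈ Set.Icc 0 τ, dX Γ (flow Γ t (proj Γ g)) (flow Γ t (proj Γ h)) < δ) :
    ∀ t ∈ Set.Icc 0 τ, dG (g * a t) (h * a t) < δ := by
  have h2 : (1 : ℝ) ≤ Real.sqrt 2 := Real.one_le_sqrt.mpr one_le_two
  -- The step is chosen so that two distances below `δ` and two movements of at most `d` add up to
  -- at most `σ₀`.
  set d := (σ₀ - 2 * δ) / 2 with hd
  have hd0 : 0 < d := by rw [hd]; linarith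
  have step : ∀ t t' : ℝ, t' ∈ Set.Icc 0 τ → |t - t'| ≤ d → dG (g * a t) (h * a t) < δ →
      dG (g * a t') (h * a t') < δ := by
    intro t t' ht' htt H
    obtain ⟨γ, hγ, H'⟩ := exists_lift_of_dX_lt Γ (hX t' ht')
    have hb : |t - t'| / Real.sqrt 2 ≤ d :=
      (div_le_self (abs_nonneg _) h2).trans htt
    have e1 := (dG_mul_a_mul_a g t t').trans hb
    have e2 := (dG_mul_a_mul_a h t t').trans hb
    have e3 : dG (h * a t') (γ * (h * a t')) ≤ σ₀ := by
      have i1 := dG_triangle (h * a t') (h * a t) (γ * (h * a t'))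
      have i2 := dG_triangle (h * a t) (g * a t) (γ * (h * a t'))
      have i3 := dG_triangle (g * a t) (g * a t') (γ * (h * a t'))
      rw [dG_comm (h * a t') (h * a t)] at i1
      rw [dG_comm (h * a t) (g * a t)] at i2
      have H'' : dG (g * a t') (γ * (h * a t')) < δ := H'
      linarith
    have := hσ.eq_one hγ e3
    rwa [this, one_mul] at H'
  have main : ∀ n : ℕ, ∀ t ∈ Set.Icc 0 τ, t ≤ n * d → dG (g * a t) (h * a t) < δ := by
    intro n
    induction n with
    | zero =>
      intro t ht htn
      have : t = 0 := le_antisymm (by simpa using htn) ht.1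
      rw [this, a_zero, mul_one, mul_one]
      exact h0
    | succ n ih =>
      intro t ht htn
      push_cast at htn
      rcases le_or_gt t (n * d) with h | h
      · exact ih t ht h
      · have hn : (0 : ℝ) ≤ n * d := by positivity
        refine step (n * d) t ht ?_ (ih _ ⟨hn, h.le.trans ht.2⟩ le_rfl)
        rw [abs_sub_comm, abs_of_pos (by linarith)]
        linarith
  intro t ht
  obtain ⟨n, hn⟩ := exists_nat_ge (t / d)
  exact main n t ht ((div_le_iff₀ hd0).mp hn)

/-- Comparing entries, each off-diagonal entry is multiplied by the difference of a number above 1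
and one below 1 in modulus, so it vanishes; the diagonal then fixes the sign and the times. -/
lemma eq_mul_a_of_conj {q : PSL2R} {τ₁ τ₂ : ℝ} (h1 : 0 < τ₁) (h2 : 0 < τ₂)
    (h : q * a τ₂ = a τ₁ * q) : τ₁ = τ₂ ∧ ∃ s, q = a s := by
  obtain ⟨Q, rfl⟩ := mk_surj q
  obtain ⟨r, hr, e⟩ := mk_eq_mk (A := aMat τ₁ * Q) (B := Q * aMat τ₂) h.symm
  have e00 := e 0 0
  have e01 := e 0 1
  have e10 := e 1 0
  have e11 := e 1 1
  simp [sl_mul_apply, coe_aMat] at e00 e01 e10 e11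
  have hd := Q.2
  rw [Matrix.det_fin_two] at hd
  have p1 : 1 < Real.exp (τ₁ / 2) := by rw [Real.one_lt_exp_iff]; linarith
  have p2 : 1 < Real.exp (τ₂ / 2) := by rw [Real.one_lt_exp_iff]; linarith
  have n1 : Real.exp (-τ₁ / 2) < 1 := by rw [Real.exp_lt_one_iff]; linarith
  have n2 : Real.exp (-τ₂ / 2) < 1 := by rw [Real.exp_lt_one_iff]; linarith
  have m1 := Real.exp_pos (-τ₁ / 2)
  have m2 := Real.exp_pos (-τ₂ / 2)
  have z01 : Q.1 0 1 = 0 := by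
    have : Q.1 0 1 * (Real.exp (-τ₂ / 2) - r * Real.exp (τ₁ / 2)) = 0 := by linarith
    rcases mul_eq_zero.mp this with h | h
    · exact h
    · rcases hr with rfl | rfl <;> linarith
  have z10 : Q.1 1 0 = 0 := by
    have : Q.1 1 0 * (Real.exp (τ₂ / 2) - r * Real.exp (-τ₁ / 2)) = 0 := by linarith
    rcases mul_eq_zero.mp this with h | h
    · exact h
    · rcases hr with rfl | rfl <;> linarith
  rw [z01, z10] at hd
  have hne : Q.1 0 0 ≠ 0 := by
    intro h0
    simp [h0] at hd
  have hE : Real.exp (τ₂ / 2) - r * Real.exp (τ₁ / 2) = 0 := by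
    have : Q.1 0 0 * (Real.exp (τ₂ / 2) - r * Real.exp (τ₁ / 2)) = 0 := by linarith
    exact (mul_eq_zero.mp this).resolve_left hne
  have hτ : τ₁ = τ₂ := by
    rcases hr with rfl | rfl
    · have := Real.exp_injective (show Real.exp (τ₂ / 2) = Real.exp (τ₁ / 2) by linarith)
      linarith
    · linarith
  refine ⟨hτ, ?_⟩
  have h11 : Q.1 1 1 = (Q.1 0 0)⁻¹ := eq_inv_of_mul_eq_one_right (by linarith)
  rcases lt_or_gt_of_ne hne with hneg | hpos
  · refine ⟨2 * Real.log (-Q.1 0 0), (mk_eq_of_neg (B := Q) ?_).symm⟩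
    have l1 : Real.exp (Real.log (Q.1 0 0)) = -Q.1 0 0 := by
      rw [← Real.log_neg_eq_log, Real.exp_log (by linarith)]
    intro i j
    fin_cases i <;> fin_cases j <;> simp [coe_aMat, z01, z10, h11, l1, neg_div, Real.exp_neg]
  · refine ⟨2 * Real.log (Q.1 0 0), ?_⟩
    unfold a
    congr 1
    apply sl_ext <;> simp [coe_aMat, z01, z10, h11, Real.exp_log hpos, neg_div, Real.exp_neg]

lemma orbit_flow (t : ℝ) (x : X Γ) : orbit Γ (flow Γ t x) = orbit Γ x := by
  ext y
  constructor
  · rintro ⟨s, rfl⟩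
    exact ⟨t + s, (flow_flow Γ s t x).symm⟩
  · rintro ⟨s, rfl⟩
    exact ⟨s - t, by simp only [flow_flow]; congr 1; ring⟩

lemma IsDisplacementBound.coincidence_of_le {σ₀ : ℝ} (hσ : IsDisplacementBound Γ σ₀) {δ : ℝ}
    (hδ : δ < σ₀ / 3) {x₁ x₂ : X Γ} {T₁ T₂ : ℝ} (hT₁ : 0 < T₁) (hT₂ : 0 < T₂)
    (hx₁ : flow Γ T₁ x₁ = x₁) (hx₂ : flow Γ T₂ x₂ = x₂) (hT : |T₁ - T₂| ≤ Real.sqrt 2 * δ)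
    (hX : ∀ t ∈ Set.Icc 0 (min T₁ T₂), dX Γ (flow Γ t x₁) (flow Γ t x₂) < δ)
    (hle : T₁ ≤ T₂) : T₁ = T₂ ∧ orbit Γ x₁ = orbit Γ x₂ := by
  obtain ⟨g, rfl⟩ := proj_surj Γ x₁
  obtain ⟨h', rfl⟩ := proj_surj Γ x₂
  have hm : min T₁ T₂ = T₁ := min_eq_left hle
  rw [hm] at hX
  have h00 := hX 0 ⟨le_rfl, hT₁.le⟩
  rw [flow_zero, flow_zero] at h00
  obtain ⟨γ, hγ, h0⟩ := exists_lift_of_dX_lt Γ h00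
  obtain ⟨h, hh⟩ : ∃ h, γ * h' = h := ⟨_, rfl⟩
  rw [← proj_mul_left Γ hγ h', hh] at hX hx₂ ⊢
  rw [hh] at h0
  have hpers := hσ.lift_persists (by linarith [hσ.1]) h0 hX T₁ ⟨hT₁.le, le_rfl⟩
  obtain ⟨γ₁, hγ₁, e1⟩ := (proj_eq_iff Γ _ _).mp hx₁.symm
  obtain ⟨γ₂, hγ₂, e2⟩ := (proj_eq_iff Γ _ _).mp hx₂.symm
  dsimp only at e1 e2
  -- Starting points, end points and the gap between the periods contribute at most `δ` each, and
  -- `3δ < σ₀`; so both lifts close up under the same deck transformation.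
  have hγγ : γ₁⁻¹ * γ₂ = 1 := by
    refine hσ.eq_one (Γ.mul_mem (Γ.inv_mem hγ₁) hγ₂) (g := h) ?_
    have i1 := dG_triangle h g (γ₁⁻¹ * γ₂ * h)
    have i2 := dG_triangle (g * a T₁) (h * a T₁) (h * a T₂)
    have i3 : dG g (γ₁⁻¹ * γ₂ * h) = dG (g * a T₁) (h * a T₂) := by
      rw [← dG_mul_left γ₁, e1, ← e2]
      congr 1
      group
    have i4 := dG_mul_a_mul_a h T₁ T₂
    have i5 : |T₁ - T₂| / Real.sqrt 2 ≤ δ := by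
      rw [div_le_iff₀ (by positivity)]
      linarith
    rw [dG_comm h g] at i1
    linarith
  have hγe : γ₁ = γ₂ := (inv_mul_eq_one.mp hγγ)
  have hq : (g⁻¹ * h) * a T₂ = a T₁ * (g⁻¹ * h) := by
    have : a T₁ = g⁻¹ * (γ₁ * g) := by rw [e1]; group
    rw [this, mul_assoc, ← e2, hγe]
    group
  obtain ⟨hTT, s, hs⟩ := eq_mul_a_of_conj hT₁ hT₂ hq
  refine ⟨hTT, ?_⟩
  have : h = g * a s := by rw [← hs]; group
  rw [this, ← flow_proj, orbit_flow]

lemma IsDisplacementBound.isCoincidenceConst {σ₀ : ℝ} (hσ : IsDisplacementBound Γ σ₀) :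
    IsCoincidenceConst Γ (σ₀ / 3) := by
  refine ⟨by linarith [hσ.1], ?_⟩
  intro δ _ hδ x₁ x₂ T₁ T₂ hT₁ hT₂ hx₁ hx₂ hT hX
  rcases le_total T₁ T₂ with h | h
  · exact hσ.coincidence_of_le hδ hT₁ hT₂ hx₁ hx₂ hT hX h
  · have := hσ.coincidence_of_le hδ hT₂ hT₁ hx₂ hx₁ (by rwa [abs_sub_comm])
      (fun t ht => by rw [dX_comm]; exact hX t (by rwa [min_comm])) h
    exact ⟨this.1.symm, this.2.symm⟩

end HadamardGutzwiller

/-! ### Reconnected partners and their uniqueness. -/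

namespace HadamardGutzwiller

lemma forall_fin_four {P : Fin 4 → Prop} : (∀ i, P i) ↔ P 0 ∧ P 1 ∧ P 2 ∧ P 3 :=
  ⟨fun h => ⟨h 0, h 1, h 2, h 3⟩, fun ⟨h0, h1, h2, h3⟩ i => by fin_cases i <;> assumption⟩

variable (Γ : Subgroup PSL2R)

/-- The indices come from the permutation: a forward piece is read from the left end of its image
and a reversed piece from the right end, whence `t' 0, t' 3` and `t' 2, t' 3`. -/
lemma piecewiseClose_api_iff (η T₁ T₂ T₃ T₄ : ℝ) (t' : Fin 5 → ℝ) (x x' : X Γ) :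
    PiecewiseClose Γ η (apiTimes T₁ T₂ T₃ T₄) t' apiPerm apiRev x x' ↔
    (∀ r ∈ Set.Icc 0 T₁, dX Γ (flow Γ r x) (flow Γ (r + t' 0) x') < η) ∧
    (∀ r ∈ Set.Icc 0 T₂, dX Γ (flow Γ (r + T₁) x) (flow Γ (r + t' 3) x') < η) ∧
    (∀ r ∈ Set.Icc 0 T₃,
      dX Γ (flow Γ (r + (T₁ + T₂)) x) (flow Γ (r - t' 2) (timeRev Γ x')) < η) ∧
    (∀ r ∈ Set.Icc 0 T₄,
      dX Γ (flow Γ (r + (T₁ + T₂ + T₃)) x) (flow Γ (r - t' 3) (timeRev Γ x')) < η) := by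
  have e0 : T₁ + T₂ - T₁ = T₂ := by ring
  have e1 : T₁ + T₂ + T₃ - (T₁ + T₂) = T₃ := by ring
  have e2 : T₁ + T₂ + T₃ + T₄ - (T₁ + T₂ + T₃) = T₄ := by ring
  have hf : ∀ p : Prop, (false = true → p) ↔ True := by simp
  have ht : ∀ p : Prop, (true = false → p) ↔ True := by simp
  unfold PiecewiseClose
  rw [forall_fin_four]
  change ((∀ r ∈ Set.Icc 0 (T₁ - 0), (false = false → dX Γ (flow Γ (r + 0) x) _ < η) ∧
      (false = true → _)) ∧
    (∀ r ∈ Set.Icc 0 (T₁ + T₂ - T₁), (false = false → _) ∧ (false = true → _)) ∧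
    (∀ r ∈ Set.Icc 0 (T₁ + T₂ + T₃ - (T₁ + T₂)), (true = false → _) ∧ (true = true → _)) ∧
    (∀ r ∈ Set.Icc 0 (T₁ + T₂ + T₃ + T₄ - (T₁ + T₂ + T₃)),
      (true = false → _) ∧ (true = true → _))) ↔ _
  simp only [hf, ht, e0, e1, e2, sub_zero, add_zero, forall_true_left, and_true, true_and]
  rfl

lemma isReconnectedPartner_iff (ε η T₁ T₂ T₃ T₄ T' : ℝ) (x x' : X Γ) (O' : Set (X Γ))
    (t' : Fin 5 → ℝ) :
    IsReconnectedPartner Γ ε η x T₁ T₂ T₃ T₄ O' T' x' t' ↔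
    IsPeriodicOrbit Γ O' T' ∧ x' ∈ O' ∧ StrictMono t' ∧ t' 0 = 0 ∧ t' 4 = T' ∧
    ((∀ r ∈ Set.Icc 0 T₁, dX Γ (flow Γ r x) (flow Γ (r + t' 0) x') < η) ∧
    (∀ r ∈ Set.Icc 0 T₂, dX Γ (flow Γ (r + T₁) x) (flow Γ (r + t' 3) x') < η) ∧
    (∀ r ∈ Set.Icc 0 T₃,
      dX Γ (flow Γ (r + (T₁ + T₂)) x) (flow Γ (r - t' 2) (timeRev Γ x')) < η) ∧
    (∀ r ∈ Set.Icc 0 T₄,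
      dX Γ (flow Γ (r + (T₁ + T₂ + T₃)) x) (flow Γ (r - t' 3) (timeRev Γ x')) < η)) ∧
    |t' 1 - t' 0 - T₁| < ε ∧ |t' 4 - t' 3 - T₂| < ε ∧ |t' 2 - t' 1 - T₃| < ε ∧
    |t' 3 - t' 2 - T₄| < ε := by
  have e0 : T₁ + T₂ - T₁ = T₂ := by ring
  have e1 : T₁ + T₂ + T₃ - (T₁ + T₂) = T₃ := by ring
  have e2 : T₁ + T₂ + T₃ + T₄ - (T₁ + T₂ + T₃) = T₄ := by ring
  unfold IsReconnectedPartner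
  rw [piecewiseClose_api_iff, forall_fin_four]
  have d0 : apiTimes T₁ T₂ T₃ T₄ (Fin.succ 0) - apiTimes T₁ T₂ T₃ T₄ (Fin.castSucc 0) = T₁ :=
    sub_zero _
  have d1 : apiTimes T₁ T₂ T₃ T₄ (Fin.succ 1) - apiTimes T₁ T₂ T₃ T₄ (Fin.castSucc 1) = T₂ := e0
  have d2 : apiTimes T₁ T₂ T₃ T₄ (Fin.succ 2) - apiTimes T₁ T₂ T₃ T₄ (Fin.castSucc 2) = T₃ := e1
  have d3 : apiTimes T₁ T₂ T₃ T₄ (Fin.succ 3) - apiTimes T₁ T₂ T₃ T₄ (Fin.castSucc 3) = T₄ := e2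
  rw [d0, d1, d2, d3]
  rfl

variable {Γ}

lemma IsReconnectedPartner.mono {ε η η' T₁ T₂ T₃ T₄ T' : ℝ} {x x' : X Γ} {O' : Set (X Γ)}
    {t' : Fin 5 → ℝ} (h : IsReconnectedPartner Γ ε η x T₁ T₂ T₃ T₄ O' T' x' t') (hη : η ≤ η') :
    IsReconnectedPartner Γ ε η' x T₁ T₂ T₃ T₄ O' T' x' t' := by
  obtain ⟨h1, h2, h3, h4, h5, h6, h7⟩ := h
  exact ⟨h1, h2, h3, h4, h5, fun j r hr => ⟨fun hj => ((h6 j r hr).1 hj).trans_le hη,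
    fun hj => ((h6 j r hr).2 hj).trans_le hη⟩, h7⟩

lemma IsPeriodicOrbit.flow_period {O : Set (X Γ)} {T : ℝ} (h : IsPeriodicOrbit Γ O T) {x : X Γ}
    (hx : x ∈ O) : flow Γ T x = x ∧ O = orbit Γ x := by
  obtain ⟨-, y, hy, rfl⟩ := h
  obtain ⟨s, rfl⟩ := hx
  refine ⟨?_, (orbit_flow s y).symm⟩
  dsimp only
  rw [flow_flow, add_comm, ← flow_flow, hy]

variable (Γ) in
lemma dX_lt_of_common {x p q : X Γ} {s t η₁ η₂ ρ κ : ℝ} (h₁ : dX Γ x (flow Γ s p) < η₁)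
    (h₂ : dX Γ x (flow Γ t q) < η₂) (hs : |s - ρ| / Real.sqrt 2 + |t - ρ| / Real.sqrt 2 ≤ κ) :
    dX Γ (flow Γ ρ p) (flow Γ ρ q) < η₁ + η₂ + κ := by
  have i1 := dX_triangle Γ (flow Γ ρ p) (flow Γ s p) (flow Γ ρ q)
  have i2 := dX_triangle Γ (flow Γ s p) x (flow Γ ρ q)
  have i3 := dX_triangle Γ x (flow Γ t q) (flow Γ ρ q)
  have i4 := dX_flow_flow Γ ρ s p
  have i5 := dX_flow_flow Γ t ρ q
  rw [dX_comm] at h₁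
  rw [abs_sub_comm] at i4
  linarith

/-- If the partner's piece is longer than the original one, the excess is compared with the end
point of the original piece. -/
lemma exists_shift {d T ε : ℝ} (hT : 0 < T) (hε : 0 < ε) (h : |d - T| < ε) {r : ℝ} (h0 : 0 ≤ r)
    (hr : r ≤ d) : ∃ r' ∈ Set.Icc 0 T, |r' - r| ≤ ε := by
  rw [abs_lt] at h
  rcases le_total r T with h1 | h1
  · exact ⟨r, ⟨h0, h1⟩, by simpa using hε.le⟩
  · exact ⟨T, ⟨hT.le, le_rfl⟩, by rw [abs_sub_comm, abs_of_nonneg (by linarith)]; linarith⟩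

/-- Two partners reconnected in the same way stay close for all times. -/
lemma IsReconnectedPartner.dX_lt {ε η₁ η₂ T₁ T₂ T₃ T₄ P₁ P₂ : ℝ} (hε : 0 < ε)
    (hT₁ : 0 < T₁) (hT₂ : 0 < T₂) (hT₃ : 0 < T₃) (hT₄ : 0 < T₄)
    {x x₁ x₂ : X Γ} {O₁ O₂ : Set (X Γ)} {t₁ t₂ : Fin 5 → ℝ}
    (h₁ : IsReconnectedPartner Γ ε η₁ x T₁ T₂ T₃ T₄ O₁ P₁ x₁ t₁)
    (h₂ : IsReconnectedPartner Γ ε η₂ x T₁ T₂ T₃ T₄ O₂ P₂ x₂ t₂) :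
    |P₁ - P₂| < 8 * ε ∧
      ∀ t ∈ Set.Icc 0 P₁, dX Γ (flow Γ t x₁) (flow Γ t x₂) < η₁ + η₂ + 8 * ε := by
  rw [isReconnectedPartner_iff] at h₁ h₂
  obtain ⟨-, -, -, p0, p4, ⟨pA, pB, pC, pD⟩, lA, lB, lC, lD⟩ := h₁
  obtain ⟨-, -, -, q0, q4, ⟨qA, qB, qC, qD⟩, kA, kB, kC, kD⟩ := h₂
  have sq2 : (7 / 5 : ℝ) ≤ Real.sqrt 2 := by
    apply Real.le_sqrt_of_sq_le
    norm_num
  have hκ : ∀ p q : ℝ, |p| + |q| ≤ 8 * ε → |p| / Real.sqrt 2 + |q| / Real.sqrt 2 ≤ 8 * ε := by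
    intro p q h
    rw [← add_div]
    refine (div_le_self (by positivity) (by linarith)).trans h
  have a1 := abs_lt.mp lA
  have a2 := abs_lt.mp lB
  have a3 := abs_lt.mp lC
  have a4 := abs_lt.mp lD
  have b1 := abs_lt.mp kA
  have b2 := abs_lt.mp kB
  have b3 := abs_lt.mp kC
  have b4 := abs_lt.mp kD
  constructor
  · rw [abs_lt]
    constructor <;> linarith
  intro t ht
  have hrev : ∀ (s : ℝ) (y : X Γ), flow Γ t y = timeRev Γ (flow Γ (-t) (timeRev Γ y)) :=
    fun s y => by rw [timeRev_flow, neg_neg, timeRev_timeRev]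
  rcases le_total t (t₁ 1) with h1 | h1
  · obtain ⟨r, hr, hr'⟩ := exists_shift hT₁ hε lA (r := t - t₁ 0) (by linarith [ht.1])
      (by linarith)
    refine dX_lt_of_common Γ (pA r hr) (qA r hr) (hκ _ _ ?_)
    have e1 : |r + t₁ 0 - t| ≤ ε := by rwa [show r + t₁ 0 - t = r - (t - t₁ 0) by ring]
    have e2 : |r + t₂ 0 - t| ≤ ε := by rwa [q0, ← p0]
    linarith
  rcases le_total t (t₁ 2) with h2 | h2
  · obtain ⟨r, hr, hr'⟩ := exists_shift hT₃ hε lC (r := t₁ 2 - t) (by linarith)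
      (by linarith)
    rw [hrev 0 x₁, hrev 0 x₂, dX_timeRev]
    refine dX_lt_of_common Γ (pC r hr) (qC r hr) (hκ _ _ ?_)
    have e1 : |r - t₁ 2 - -t| ≤ ε := by rwa [show r - t₁ 2 - -t = r - (t₁ 2 - t) by ring]
    have e2 : |r - t₂ 2 - -t| ≤ 7 * ε := by
      rw [abs_le] at e1 ⊢
      constructor <;> linarith
    linarith
  rcases le_total t (t₁ 3) with h3 | h3
  · obtain ⟨r, hr, hr'⟩ := exists_shift hT₄ hε lD (r := t₁ 3 - t) (by linarith)
      (by linarith)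
    rw [hrev 0 x₁, hrev 0 x₂, dX_timeRev]
    refine dX_lt_of_common Γ (pD r hr) (qD r hr) (hκ _ _ ?_)
    have e1 : |r - t₁ 3 - -t| ≤ ε := by rwa [show r - t₁ 3 - -t = r - (t₁ 3 - t) by ring]
    -- Each piece shifts the two time scales by at most `2ε` against each other; three pieces
    -- precede, and `exists_shift` costs one more `ε`.
    have e2 : |r - t₂ 3 - -t| ≤ 7 * ε := by
      rw [abs_le] at e1 ⊢
      constructor <;> linarith
    linarith
  · obtain ⟨r, hr, hr'⟩ := exists_shift hT₂ hε lB (r := t - t₁ 3) (by linarith)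
      (by linarith [ht.2])
    refine dX_lt_of_common Γ (pB r hr) (qB r hr) (hκ _ _ ?_)
    have e1 : |r + t₁ 3 - t| ≤ ε := by rwa [show r + t₁ 3 - t = r - (t - t₁ 3) by ring]
    have e2 : |r + t₂ 3 - t| ≤ 7 * ε := by
      rw [abs_le] at e1 ⊢
      constructor <;> linarith
    linarith

/-- Uniqueness of the partner, given one that is closer than required. -/
lemma IsCoincidenceConst.eq_partner {ε εs T₁ T₂ T₃ T₄ P₁ P₂ : ℝ} (hεs : IsCoincidenceConst Γ εs)
    (hε : 0 < ε) (hlt : ε < εs / 38)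
    (hT₁ : 0 < T₁) (hT₂ : 0 < T₂) (hT₃ : 0 < T₃) (hT₄ : 0 < T₄)
    {x x₁ x₂ : X Γ} {O₁ O₂ : Set (X Γ)} {t₁ t₂ : Fin 5 → ℝ}
    (h₁ : IsReconnectedPartner Γ ε (19 * ε) x T₁ T₂ T₃ T₄ O₁ P₁ x₁ t₁)
    (h₂ : IsReconnectedPartner Γ ε (10 * ε) x T₁ T₂ T₃ T₄ O₂ P₂ x₂ t₂) :
    P₁ = P₂ ∧ O₁ = O₂ := by
  obtain ⟨hP, hX⟩ := h₁.dX_lt hε hT₁ hT₂ hT₃ hT₄ h₂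
  obtain ⟨f₁, o₁⟩ := h₁.1.flow_period h₁.2.1
  obtain ⟨f₂, o₂⟩ := h₂.1.flow_period h₂.2.1
  have sq2 : (1 : ℝ) ≤ Real.sqrt 2 := Real.one_le_sqrt.mpr one_le_two
  rw [o₁, o₂]
  -- The distance stays below `19ε + 10ε + 8ε = 37ε`.
  refine hεs.2 (38 * ε) (by linarith) (by linarith) x₁ x₂ P₁ P₂ h₁.1.1 h₂.1.1 f₁ f₂ ?_ ?_
  · nlinarith
  · intro t ht
    have := hX t ⟨ht.1, ht.2.trans (min_le_left _ _)⟩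
    linarith

end HadamardGutzwiller

/-! ### Cycles of slope maps, and the hops in coordinates. -/

namespace HadamardGutzwiller

/-- A cycle of four continuous maps of intervals has a periodic point. -/
lemma exists_cycle {f₀ f₁ f₂ f₃ : ℝ → ℝ} {r₀ r₁ r₂ r₃ : ℝ} (h0 : 0 ≤ r₀)
    (c₀ : ContinuousOn f₀ (Set.Icc (-r₁) r₁)) (c₁ : ContinuousOn f₁ (Set.Icc (-r₂) r₂))
    (c₂ : ContinuousOn f₂ (Set.Icc (-r₃) r₃)) (c₃ : ContinuousOn f₃ (Set.Icc (-r₀) r₀))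
    (m₀ : Set.MapsTo f₀ (Set.Icc (-r₁) r₁) (Set.Icc (-r₀) r₀))
    (m₁ : Set.MapsTo f₁ (Set.Icc (-r₂) r₂) (Set.Icc (-r₁) r₁))
    (m₂ : Set.MapsTo f₂ (Set.Icc (-r₃) r₃) (Set.Icc (-r₂) r₂))
    (m₃ : Set.MapsTo f₃ (Set.Icc (-r₀) r₀) (Set.Icc (-r₃) r₃)) :
    ∃ v₀ v₁ v₂ v₃ : ℝ, v₀ = f₀ v₁ ∧ v₁ = f₁ v₂ ∧ v₂ = f₂ v₃ ∧ v₃ = f₃ v₀ ∧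
      |v₀| ≤ r₀ ∧ |v₁| ≤ r₁ ∧ |v₂| ≤ r₂ ∧ |v₃| ≤ r₃ := by
  -- The composite of the four maps sends an interval to itself, so the intermediate value theorem
  -- gives a fixed point; no contraction estimate is needed.
  obtain ⟨v, hv, hf⟩ := exists_mem_Icc_isFixedPt_of_mapsTo
    (c₀.comp (c₁.comp (c₂.comp c₃ m₃) (m₂.comp m₃)) (m₁.comp (m₂.comp m₃))) (by linarith)
    (m₀.comp (m₁.comp (m₂.comp m₃)))
  exact ⟨v, f₁ (f₂ (f₃ v)), f₂ (f₃ v), f₃ v, hf.symm, rfl, rfl, rfl, abs_le.mpr hv,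
    abs_le.mpr (m₁ (m₂ (m₃ hv))), abs_le.mpr (m₂ (m₃ hv)), abs_le.mpr (m₃ hv)⟩

/-- The action of `c u * b s` on slopes. -/
noncomputable def slopeCB (u s v : ℝ) : ℝ := u + v / (1 + s * v)

/-- The action of `b (-s) * c (-u)` on slopes. -/
noncomputable def slopeBC (u s v : ℝ) : ℝ := (v - u) / (1 - s * (v - u))

lemma abs_mul_le_of {ε k p q : ℝ} (hε : 72 * ε ^ 2 ≤ 1) (hε0 : 0 ≤ ε) (hk : 0 ≤ k)
    (hp : |p| ≤ ε) (hq : |q| ≤ k * ε) : |p * q| ≤ k / 72 := by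
  rw [abs_mul]
  have : |p| * |q| ≤ ε * (k * ε) := mul_le_mul hp hq (abs_nonneg _) hε0
  nlinarith

/-- The denominator is at least `1 - k / 72`, so `hR` is exactly what lets radius `kε` be mapped
into radius `Rε`. -/
lemma abs_slopeCB_le {ε k R u s v : ℝ} (hε : 72 * ε ^ 2 ≤ 1) (hε0 : 0 ≤ ε) (hk : 0 ≤ k)
    (hk' : k ≤ 36) (hR : k ≤ (R - 1) * (1 - k / 72)) (hu : |u| ≤ ε) (hs : |s| ≤ ε)
    (hv : |v| ≤ k * ε) : 1 / 2 ≤ 1 + s * v ∧ |v / (1 + s * v)| ≤ (R - 1) * ε ∧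
      |slopeCB u s v| ≤ R * ε := by
  have h1 := abs_le.mp (abs_mul_le_of hε hε0 hk hs hv)
  have h2 : 1 / 2 ≤ 1 + s * v := by linarith
  have h4 : |v / (1 + s * v)| ≤ (R - 1) * ε := by
    rw [abs_div, abs_of_pos (show 0 < 1 + s * v by linarith), div_le_iff₀ (by linarith)]
    have : 0 ≤ R - 1 := by
      by_contra h
      nlinarith
    calc |v| ≤ k * ε := hv
      _ ≤ (R - 1) * (1 - k / 72) * ε := mul_le_mul_of_nonneg_right hR hε0
      _ = (R - 1) * ε * (1 - k / 72) := by ring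
      _ ≤ _ := mul_le_mul_of_nonneg_left (by linarith) (by positivity)
  refine ⟨h2, h4, ?_⟩
  unfold slopeCB
  calc |u + v / (1 + s * v)| ≤ |u| + |v / (1 + s * v)| := abs_add_le _ _
    _ ≤ R * ε := by linarith

lemma abs_slopeBC_le {ε k R u s v : ℝ} (hε : 72 * ε ^ 2 ≤ 1) (hε0 : 0 ≤ ε) (hk : 0 ≤ k)
    (hk' : k ≤ 35) (hR : k + 1 ≤ R * (1 - (k + 1) / 72)) (hu : |u| ≤ ε) (hs : |s| ≤ ε)
    (hv : |v| ≤ k * ε) : 1 / 2 ≤ 1 - s * (v - u) ∧ |slopeBC u s v| ≤ R * ε := by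
  have h0 : |v - u| ≤ (k + 1) * ε := (abs_sub v u).trans (by linarith)
  have h1 := abs_le.mp (abs_mul_le_of hε hε0 (by linarith) hs h0)
  have h2 : 1 / 2 ≤ 1 - s * (v - u) := by linarith
  refine ⟨h2, ?_⟩
  unfold slopeBC
  rw [abs_div, abs_of_pos (show 0 < 1 - s * (v - u) by linarith), div_le_iff₀ (by linarith)]
  have : 0 ≤ R := by
    by_contra h
    nlinarith
  calc |v - u| ≤ (k + 1) * ε := h0
    _ ≤ R * (1 - (k + 1) / 72) * ε := mul_le_mul_of_nonneg_right hR hε0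
    _ = R * ε * (1 - (k + 1) / 72) := by ring
    _ ≤ _ := mul_le_mul_of_nonneg_left (by linarith) (by positivity)

lemma continuousOn_slopeCB {u s r : ℝ} (h : ∀ v ∈ Set.Icc (-r) r, 1 / 2 ≤ 1 + s * v) :
    ContinuousOn (slopeCB u s) (Set.Icc (-r) r) := by
  unfold slopeCB
  exact continuousOn_const.add (continuousOn_id.div (by fun_prop) fun v hv => by linarith [h v hv])

lemma continuousOn_slopeBC {u s r : ℝ} (h : ∀ v ∈ Set.Icc (-r) r, 1 / 2 ≤ 1 - s * (v - u)) :
    ContinuousOn (slopeBC u s) (Set.Icc (-r) r) := by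
  unfold slopeBC
  exact ContinuousOn.div (by fun_prop) (by fun_prop) fun v hv => by linarith [h v hv]

/-- Slopes of the unstable directions of the partner orbit at the four encounter passages. -/
lemma exists_unstable_slopes {ε u₁ s₁ u₂ s₂ E₀ E₁ E₂ E₃ : ℝ} (hε : 72 * ε ^ 2 ≤ 1)
    (hε0 : 0 ≤ ε) (hu₁ : |u₁| ≤ ε) (hs₁ : |s₁| ≤ ε) (hu₂ : |u₂| ≤ ε) (hs₂ : |s₂| ≤ ε)
    (p₀ : 0 ≤ E₀) (p₁ : 0 ≤ E₁) (p₂ : 0 ≤ E₂) (p₃ : 0 ≤ E₃)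
    (l₀ : E₀ ≤ 1) (l₁ : E₁ ≤ 1 / 9) (l₂ : E₂ ≤ 1 / 5) (l₃ : E₃ ≤ 1 / 2) :
    ∃ v₀ v₁ v₂ v₃ : ℝ, v₀ = E₀ * slopeCB u₂ s₂ v₁ ∧ v₁ = E₁ * slopeCB s₁ u₁ v₂ ∧
      v₂ = E₂ * slopeBC u₂ s₂ v₃ ∧ v₃ = E₃ * slopeBC u₁ s₁ v₀ ∧
      |v₀| ≤ 5 / 4 * ε * E₀ ∧ |v₁| ≤ 3 / 2 * ε * E₁ ∧ |v₂| ≤ 23 / 10 * ε * E₂ ∧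
      |v₃| ≤ 12 / 5 * ε * E₃ := by
  have bound : ∀ {E l R : ℝ} {v : ℝ}, 0 ≤ R → E ≤ l → v ∈ Set.Icc (-(R * ε * E)) (R * ε * E) →
      |v| ≤ R * l * ε := by
    intro E l R v hR hl hv
    have : |v| ≤ R * ε * E := abs_le.mpr hv
    have h2 : R * ε * E ≤ R * ε * l := mul_le_mul_of_nonneg_left hl (by positivity)
    linarith
  have maps : ∀ {E R x : ℝ}, 0 ≤ E → |x| ≤ R * ε → E * x ∈ Set.Icc (-(R * ε * E)) (R * ε * E) := by
    intro E R x hE hx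
    have := abs_le.mp hx
    constructor <;> nlinarith
  -- The radii `5/4, 3/2, 23/10, 12/5` are cyclically consistent: each one, times the bound `1, 1/9,
  -- 1/5, 1/2` of its piece, is admissible input for the preceding map.
  have b₀ := fun v hv => abs_slopeCB_le (R := 5 / 4) hε hε0 (by norm_num) (by norm_num)
    (by norm_num) hu₂ hs₂ (bound (v := v) (by norm_num : (0 : ℝ) ≤ 3 / 2) l₁ hv)
  have b₁ := fun v hv => abs_slopeCB_le (R := 3 / 2) hε hε0 (by norm_num) (by norm_num)
    (by norm_num) hs₁ hu₁ (bound (v := v) (by norm_num : (0 : ℝ) ≤ 23 / 10) l₂ hv)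
  have b₂ := fun v hv => abs_slopeBC_le (R := 23 / 10) hε hε0 (by norm_num) (by norm_num)
    (by norm_num) hu₂ hs₂ (bound (v := v) (by norm_num : (0 : ℝ) ≤ 12 / 5) l₃ hv)
  have b₃ := fun v hv => abs_slopeBC_le (R := 12 / 5) hε hε0 (by norm_num) (by norm_num)
    (by norm_num) hu₁ hs₁ (bound (v := v) (by norm_num : (0 : ℝ) ≤ 5 / 4) l₀ hv)
  exact exists_cycle (by positivity)
    (continuousOn_const.mul (continuousOn_slopeCB fun v hv => (b₀ v hv).1))
    (continuousOn_const.mul (continuousOn_slopeCB fun v hv => (b₁ v hv).1))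
    (continuousOn_const.mul (continuousOn_slopeBC fun v hv => (b₂ v hv).1))
    (continuousOn_const.mul (continuousOn_slopeBC fun v hv => (b₃ v hv).1))
    (fun v hv => maps p₀ (b₀ v hv).2.2) (fun v hv => maps p₁ (b₁ v hv).2.2)
    (fun v hv => maps p₂ (b₂ v hv).2) (fun v hv => maps p₃ (b₃ v hv).2)

/-- Inverse slopes of the stable directions of the partner orbit at the four encounter
passages. -/
lemma exists_stable_slopes {ε u₁ s₁ u₂ s₂ E₀ E₁ E₂ E₃ : ℝ} (hε : 72 * ε ^ 2 ≤ 1)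
    (hε0 : 0 ≤ ε) (hu₁ : |u₁| ≤ ε) (hs₁ : |s₁| ≤ ε) (hu₂ : |u₂| ≤ ε) (hs₂ : |s₂| ≤ ε)
    (p₀ : 0 ≤ E₀) (p₁ : 0 ≤ E₁) (p₂ : 0 ≤ E₂) (p₃ : 0 ≤ E₃)
    (l₀ : E₀ ≤ 1) (l₁ : E₁ ≤ 1 / 9) (l₂ : E₂ ≤ 1 / 5) (l₃ : E₃ ≤ 1 / 2) :
    ∃ n₀ n₁ n₂ n₃ : ℝ, n₁ = slopeCB (-s₂) (-u₂) (E₀ * n₀) ∧ n₂ = slopeCB (-u₁) (-s₁) (E₁ * n₁) ∧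
      n₃ = slopeBC (-s₂) (-u₂) (E₂ * n₂) ∧ n₀ = slopeBC (-s₁) (-u₁) (E₃ * n₃) ∧
      |n₀| ≤ 9 / 5 * ε ∧ |n₁| ≤ 29 / 10 * ε ∧ |n₂| ≤ 7 / 5 * ε ∧ |n₃| ≤ 7 / 5 * ε := by
  have bound : ∀ {E l R : ℝ} {v : ℝ}, 0 ≤ R → 0 ≤ E → E ≤ l → v ∈ Set.Icc (-(R * ε)) (R * ε) →
      |E * v| ≤ R * l * ε := by
    intro E l R v hR hE hl hv
    have h1 : |v| ≤ R * ε := abs_le.mpr hv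
    rw [abs_mul, abs_of_nonneg hE]
    calc E * |v| ≤ l * (R * ε) := mul_le_mul hl h1 (abs_nonneg _) (hE.trans hl)
      _ = _ := by ring
  have b₀ := fun v hv => abs_slopeCB_le (R := 29 / 10) hε hε0 (by norm_num) (by norm_num)
    (by norm_num) (by rwa [abs_neg]) (by rwa [abs_neg])
    (bound (v := v) (by norm_num : (0 : ℝ) ≤ 9 / 5) p₀ l₀ hv) (u := -s₂) (s := -u₂)
  have b₁ := fun v hv => abs_slopeCB_le (R := 7 / 5) hε hε0 (by norm_num) (by norm_num)
    (by norm_num) (by rwa [abs_neg]) (by rwa [abs_neg])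
    (bound (v := v) (by norm_num : (0 : ℝ) ≤ 29 / 10) p₁ l₁ hv) (u := -u₁) (s := -s₁)
  have b₂ := fun v hv => abs_slopeBC_le (R := 7 / 5) hε hε0 (by norm_num) (by norm_num)
    (by norm_num) (by rwa [abs_neg]) (by rwa [abs_neg])
    (bound (v := v) (by norm_num : (0 : ℝ) ≤ 7 / 5) p₂ l₂ hv) (u := -s₂) (s := -u₂)
  have b₃ := fun v hv => abs_slopeBC_le (R := 9 / 5) hε hε0 (by norm_num) (by norm_num)
    (by norm_num) (by rwa [abs_neg]) (by rwa [abs_neg])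
    (bound (v := v) (by norm_num : (0 : ℝ) ≤ 7 / 5) p₃ l₃ hv) (u := -s₁) (s := -u₁)
  have cCB : ∀ {u s E r : ℝ}, (∀ v ∈ Set.Icc (-r) r, 1 / 2 ≤ 1 + s * (E * v)) →
      ContinuousOn (fun v => slopeCB u s (E * v)) (Set.Icc (-r) r) := by
    intro u s E r h
    unfold slopeCB
    exact continuousOn_const.add (ContinuousOn.div (by fun_prop) (by fun_prop)
      fun v hv => by linarith [h v hv])
  have cBC : ∀ {u s E r : ℝ}, (∀ v ∈ Set.Icc (-r) r, 1 / 2 ≤ 1 - s * (E * v - u)) →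
      ContinuousOn (fun v => slopeBC u s (E * v)) (Set.Icc (-r) r) := by
    intro u s E r h
    unfold slopeBC
    exact ContinuousOn.div (by fun_prop) (by fun_prop) fun v hv => by linarith [h v hv]
  -- Stable slopes propagate forward in time, opposite to unstable ones, so the cycle runs through
  -- the passages in reverse order.
  obtain ⟨n₀, n₃, n₂, n₁, e0, e3, e2, e1, q0, q3, q2, q1⟩ := exists_cycle (by positivity)
    (cBC fun v hv => (b₃ v hv).1) (cBC fun v hv => (b₂ v hv).1)
    (cCB fun v hv => (b₁ v hv).1) (cCB fun v hv => (b₀ v hv).1)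
    (fun v hv => abs_le.mp (b₃ v hv).2) (fun v hv => abs_le.mp (b₂ v hv).2)
    (fun v hv => abs_le.mp (b₁ v hv).2.2) (fun v hv => abs_le.mp (b₀ v hv).2.2)
  exact ⟨n₀, n₁, n₂, n₃, e1, e2, e3, e0, q0, q1, q2, q3⟩

lemma exp_half_two_log {x : ℝ} (hx : 0 < x) : Real.exp (2 * Real.log x / 2) = x ∧
    Real.exp (-(2 * Real.log x) / 2) = x⁻¹ := by
  have : Real.exp (2 * Real.log x / 2) = x := by
    rw [mul_div_cancel_left₀ _ two_ne_zero, Real.exp_log hx]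
  exact ⟨this, by rw [neg_div, Real.exp_neg, this]⟩

/-- Coordinates of a point of the partner orbit before and after the hop `c u * b s`. -/
lemma hop_cb {u s v n N : ℝ} (hl : 0 < 1 + s * v) (hm : 1 - u * N ≠ 0) (hd : 1 - v * n ≠ 0)
    (hn : n = slopeCB (-s) (-u) N) :
    c u * b s * (c v * b (n / (1 - v * n))) =
      c (slopeCB u s v) * b (N / (1 - slopeCB u s v * N)) * a (2 * Real.log (1 + s * v)) := by
  obtain ⟨ex1, ex2⟩ := exp_half_two_log hl
  -- The hop scales the first column `(1, v)` by `l`; the inverse hop scales `(N, 1)` by `m`. The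
  -- quantity `D` links the normalisations of the stable coordinate on the two sides, `D / m` and `D
  -- / l`.
  obtain ⟨l, hl'⟩ : ∃ l, l = 1 + s * v := ⟨_, rfl⟩
  obtain ⟨m, hm'⟩ : ∃ m, m = 1 - u * N := ⟨_, rfl⟩
  obtain ⟨D, hD⟩ : ∃ D, D = l * m - v * N := ⟨_, rfl⟩
  rw [← hl'] at hl ex1 ex2 ⊢
  rw [← hm'] at hm
  have hl0 := hl.ne'
  have e1 : n = (N - s * m) / m := by
    rw [hn, slopeCB]
    rw [show 1 + -u * N = m by rw [hm']; ring]
    field_simp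
    ring
  have e2 : 1 - v * n = D / m := by
    rw [e1, hD, hl']
    field_simp
    ring
  have hD0 : D ≠ 0 := by
    intro h
    rw [e2, h, zero_div] at hd
    exact hd rfl
  have e3 : n / (1 - v * n) = (N - s * m) / D := by
    rw [e2, e1]
    field_simp
  have e4 : slopeCB u s v = (u * l + v) / l := by
    rw [slopeCB, ← hl']
    field_simp
  have e5 : 1 - slopeCB u s v * N = D / l := by
    rw [e4, hD, hm']
    field_simp
    ring
  rw [e5, e3, e4]
  unfold a b c
  simp only [← mk_mul]
  congr 1
  apply sl_ext <;> simp [coe_aMat, coe_bMat, coe_cMat, sl_mul_apply, Real.exp_log hl, ex2] <;>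
    field_simp <;> (try rw [hD]) <;> (try rw [hm']) <;> (try rw [hl']) <;> ring

/-- Coordinates of a point of the partner orbit before and after the hop `b (-s) * c (-u)`. -/
lemma hop_bc {u s v n N : ℝ} (hl : 0 < 1 - s * (v - u)) (hm : 1 + u * (N + s) ≠ 0)
    (hd : 1 - v * n ≠ 0) (hn : n = slopeBC (-s) (-u) N) :
    b (-s) * c (-u) * (c v * b (n / (1 - v * n))) =
      c (slopeBC u s v) * b (N / (1 - slopeBC u s v * N)) *
        a (2 * Real.log (1 - s * (v - u))) := by
  obtain ⟨ex1, ex2⟩ := exp_half_two_log hl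
  obtain ⟨l, hl'⟩ : ∃ l, l = 1 - s * (v - u) := ⟨_, rfl⟩
  obtain ⟨m, hm'⟩ : ∃ m, m = 1 + u * (N + s) := ⟨_, rfl⟩
  obtain ⟨D, hD⟩ : ∃ D, D = 1 - (v - u) * (N + s) := ⟨_, rfl⟩
  rw [← hl'] at hl ex1 ex2 ⊢
  rw [← hm'] at hm
  have hl0 := hl.ne'
  have e1 : n = (N + s) / m := by
    rw [hn, slopeBC]
    rw [show 1 - -u * (N - -s) = m by rw [hm']; ring, sub_neg_eq_add]
  have e2 : 1 - v * n = D / m := by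
    rw [e1, eq_div_iff hm, sub_mul, mul_assoc, div_mul_cancel₀ _ hm, hD, hm']
    ring
  have hD0 : D ≠ 0 := by
    intro h
    rw [e2, h, zero_div] at hd
    exact hd rfl
  have e3 : n / (1 - v * n) = (N + s) / D := by
    rw [e2, e1]
    field_simp
  have e4 : slopeBC u s v = (v - u) / l := by
    rw [slopeBC, ← hl']
  have e5 : 1 - slopeBC u s v * N = D / l := by
    rw [e4, eq_div_iff hl0, sub_mul, mul_right_comm, div_mul_cancel₀ _ hl0, hD, hl']
    ring
  rw [e5, e3, e4]
  unfold a b c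
  simp only [← mk_mul]
  congr 1
  apply sl_ext <;> simp [coe_aMat, coe_bMat, coe_cMat, sl_mul_apply, Real.exp_log hl, ex2] <;>
    field_simp <;> (try rw [hD]) <;> (try rw [hl']) <;> ring

end HadamardGutzwiller

/-! ### Quantitative bounds on the partner's coordinates and on the action difference. -/

namespace HadamardGutzwiller

lemma abs_log_one_add_le {x : ℝ} (hx : |x| ≤ 1 / 16) : |Real.log (1 + x)| ≤ 16 / 15 * |x| := by
  have h := abs_le.mp hx
  have hp : 0 < 1 + x := by linarith
  have h1 := Real.log_le_sub_one_of_pos hp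
  have h2 := Real.one_sub_inv_le_log_of_pos hp
  have h3 : 1 - (1 + x)⁻¹ = x / (1 + x) := by field_simp; ring
  rw [h3] at h2
  have h4 : |x / (1 + x)| ≤ 16 / 15 * |x| := by
    rw [abs_div, abs_of_pos hp, div_le_iff₀ hp]
    nlinarith [abs_nonneg x]
  rw [abs_le] at h4 ⊢
  have := le_abs_self x
  have := abs_nonneg x
  constructor <;> linarith

lemma cb_mul_a (v w r : ℝ) :
    c v * b w * a r = a r * (c (v * Real.exp r) * b (w * Real.exp (-r))) := by
  rw [mul_assoc, b_mul_a, ← mul_assoc, c_mul_a, mul_assoc]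

/-- Passage of the partner along one piece of the original orbit. -/
lemma passage {V n L τ : ℝ} {H q : PSL2R}
    (h : H * q = c V * b (Real.exp (-L) * n / (1 - V * (Real.exp (-L) * n))) * a τ) :
    c (Real.exp (-L) * V) * b (n / (1 - Real.exp (-L) * V * n)) * a (L + τ) =
      a L * (H * q) := by
  rw [h, a_add, ← mul_assoc, cb_mul_a, mul_assoc]
  congr 4
  · rw [mul_right_comm, ← Real.exp_add]
    simp
  · ring_nf

lemma abs_div_one_sub_le {v n ε R S : ℝ} (h : |v * n| ≤ 1 / 20) (hn : |n| ≤ S * ε)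
    (hR : S ≤ 19 / 20 * R) (hε : 0 ≤ ε) : 1 - v * n ≠ 0 ∧ |n / (1 - v * n)| ≤ R * ε := by
  have := abs_le.mp h
  have hp : 0 < 1 - v * n := by linarith
  refine ⟨hp.ne', ?_⟩
  rw [abs_div, abs_of_pos hp, div_le_iff₀ hp]
  have h1 : S * ε ≤ 19 / 20 * R * ε := mul_le_mul_of_nonneg_right hR hε
  have h2 : 0 ≤ R * ε := by nlinarith [abs_nonneg n]
  nlinarith

/-- The hypotheses on the two encounters, `E i` being the contraction along the `i`-th piece in
the order in which the partner runs through them. -/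
structure EncounterBounds (ε u₁ s₁ u₂ s₂ E₀ E₁ E₂ E₃ : ℝ) : Prop where
  pos : 0 < ε
  small : 72 * ε ^ 2 ≤ 1
  hu₁ : |u₁| ≤ ε
  hs₁ : |s₁| ≤ ε
  hu₂ : |u₂| ≤ ε
  hs₂ : |s₂| ≤ ε
  p₀ : 0 < E₀
  p₁ : 0 < E₁
  p₂ : 0 < E₂
  p₃ : 0 < E₃
  l₀ : E₀ ≤ 1
  l₁ : E₁ ≤ 1 / 9
  l₂ : E₂ ≤ 1 / 5
  l₃ : E₃ ≤ 1 / 2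
  lt_u₁ : 9 * ε * E₁ < |u₁|
  lt_s₁ : 5 * ε * E₂ + 2 * ε * E₃ < |s₁|

/-- Coordinates `(v, w)` of the partner orbit relative to the original orbit at its four encounter
passages, and the corrections `τ` to the lengths of the pieces. -/
structure PartnerCoords (ε u₁ s₁ u₂ s₂ T₁ T₂ T₃ T₄ v₀ v₁ v₂ v₃ w₀ w₁ w₂ w₃ τ₀ τ₁ τ₂ τ₃ : ℝ) :
    Prop where
  pass₀ : c v₀ * b w₀ * a (T₁ + τ₀) = a T₁ * (c u₂ * b s₂ * (c v₁ * b w₁))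
  pass₁ : c v₁ * b w₁ * a (T₃ + τ₁) = a T₃ * (c s₁ * b u₁ * (c v₂ * b w₂))
  pass₂ : c v₂ * b w₂ * a (T₄ + τ₂) = a T₄ * (b (-s₂) * c (-u₂) * (c v₃ * b w₃))
  pass₃ : c v₃ * b w₃ * a (T₂ + τ₃) = a T₂ * (b (-s₁) * c (-u₁) * (c v₀ * b w₀))
  hv₀ : |v₀| ≤ 5 / 4 * ε * Real.exp (-T₁)
  hv₁ : |v₁| ≤ 3 / 2 * ε * Real.exp (-T₃)
  hv₂ : |v₂| ≤ 23 / 10 * ε * Real.exp (-T₄)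
  hv₃ : |v₃| ≤ 12 / 5 * ε * Real.exp (-T₂)
  hw₀ : |w₀| ≤ 2 * ε
  hw₁ : |w₁| ≤ 16 / 5 * ε
  hw₂ : |w₂| ≤ 3 / 2 * ε
  hw₃ : |w₃| ≤ 3 / 2 * ε
  hτ₀ : |τ₀| ≤ ε / 2
  hτ₁ : |τ₁| ≤ ε / 3
  hτ₂ : |τ₂| ≤ 9 / 10 * ε
  hτ₃ : |τ₃| ≤ 9 / 10 * ε
  w₀_ne : w₀ ≠ 0
  v₁_ne : v₁ ≠ 0
  w₂_ne : w₂ ≠ 0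
  action : |(τ₀ + τ₁ + τ₂ + τ₃) / 2 - Real.log ((1 + s₁ * u₁) * (1 + s₂ * u₂))| ≤
    25 * ε ^ 2 * (Real.exp (-T₁) + Real.exp (-T₂) + Real.exp (-T₃) + Real.exp (-T₄))

lemma EncounterBounds.abs_slope_step {ε s q R E l : ℝ} (hε0 : 0 < ε) (hε : 72 * ε ^ 2 ≤ 1)
    (hs : |s| ≤ ε) (hq : |q| ≤ R * ε * E) (hR : 0 ≤ R) (hE : 0 ≤ E) (hEl : E ≤ l) :
    |s * q| ≤ R * ε ^ 2 * E ∧ |s * q| ≤ R * l / 72 ∧ |s * q| ≤ R * l * ε / 8 := by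
  have h1 : |s * q| ≤ R * ε ^ 2 * E := by
    rw [abs_mul]
    calc |s| * |q| ≤ ε * (R * ε * E) := mul_le_mul hs hq (abs_nonneg _) hε0.le
      _ = _ := by ring
  have hRl : 0 ≤ R * l := mul_nonneg hR (hE.trans hEl)
  have h2 : R * ε ^ 2 * E ≤ R * l * ε ^ 2 := by
    have : R * E ≤ R * l := mul_le_mul_of_nonneg_left hEl hR
    nlinarith [sq_nonneg ε]
  have h8 : ε ≤ 1 / 8 := by nlinarith
  have h3 : ε ^ 2 ≤ ε / 8 := by nlinarith
  refine ⟨h1, h1.trans (h2.trans ?_), h1.trans (h2.trans ?_)⟩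
  · nlinarith
  · nlinarith

lemma abs_mul_le_twentieth {ε v n E l R S : ℝ} (hε : 72 * ε ^ 2 ≤ 1) (hε0 : 0 < ε)
    (hv : |v| ≤ R * ε * E) (hn : |n| ≤ S * ε) (hE : 0 ≤ E) (hl : E ≤ l) (hR : 0 ≤ R) (hS : 0 ≤ S)
    (hRS : R * S * l ≤ 3) : |v * n| ≤ 1 / 20 := by
  rw [abs_mul]
  calc |v| * |n| ≤ (R * ε * E) * (S * ε) := mul_le_mul hv hn (abs_nonneg _) (by positivity)
    _ = R * S * E * ε ^ 2 := by ring
    _ ≤ R * S * l * ε ^ 2 := mul_le_mul_of_nonneg_right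
        (mul_le_mul_of_nonneg_left hl (by positivity)) (by positivity)
    _ ≤ 3 * ε ^ 2 := mul_le_mul_of_nonneg_right hRS (by positivity)
    _ ≤ 1 / 20 := by linarith

lemma abs_contract_le {ε E n S l : ℝ} (hε0 : 0 < ε) (hE : 0 < E) (hl : E ≤ l) (hn : |n| ≤ S * ε)
    (hS : 0 ≤ S) : |E * n| ≤ S * E * ε ∧ |E * n| ≤ S * l * ε := by
  have h1 : |E * n| ≤ S * E * ε := by
    rw [abs_mul, abs_of_pos hE]
    nlinarith
  refine ⟨h1, h1.trans ?_⟩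
  have : S * E ≤ S * l := mul_le_mul_of_nonneg_left hl hS
  nlinarith

lemma abs_log_sub_log_le {p q : ℝ} (hp' : |p| ≤ 1 / 72) (hq : |q| ≤ 1 / 30) :
    |Real.log (1 + p - q) - Real.log (1 + p)| ≤ 6 / 5 * |q| := by
  have h1 := abs_le.mp hp'
  have h3 := abs_le.mp hq
  have hp : 0 < 1 + p := by linarith
  have hpq : 0 < 1 + p - q := by linarith
  rw [← Real.log_div hpq.ne' hp.ne', sub_div, div_self hp.ne', sub_eq_add_neg]
  have h2 : |-(q / (1 + p))| ≤ 72 / 71 * |q| := by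
    rw [abs_neg, abs_div, abs_of_pos hp, div_le_iff₀ hp]
    nlinarith [abs_nonneg q]
  have := abs_log_one_add_le (h2.trans (by linarith))
  linarith [abs_nonneg q]

lemma abs_action_le {ε p q a₀ a₁ a₂ a₃ E₀ E₁ E₂ E₃ : ℝ} (hε0 : 0 < ε)
    (p₀ : 0 < E₀) (p₁ : 0 < E₁) (p₂ : 0 < E₂) (p₃ : 0 < E₃)
    (hp : |p| ≤ 1 / 72) (hq : |q| ≤ 1 / 72)
    (h₀ : |a₀| ≤ 1 / 30) (h₁ : |a₁| ≤ 1 / 30) (h₂ : |a₂| ≤ 1 / 30) (h₃ : |a₃| ≤ 1 / 30)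
    (b₀ : |a₀| ≤ 3 * ε ^ 2 * E₁) (b₁ : |a₁| ≤ 3 * ε ^ 2 * E₂) (b₂ : |a₂| ≤ 3 * ε ^ 2 * E₃)
    (b₃ : |a₃| ≤ 3 * ε ^ 2 * E₀) :
    |(2 * Real.log (1 + a₀) + 2 * Real.log (1 + a₁) + 2 * Real.log (1 + q - a₂) +
      2 * Real.log (1 + p - a₃)) / 2 - Real.log ((1 + p) * (1 + q))| ≤
      25 * ε ^ 2 * (E₀ + E₃ + E₁ + E₂) := by
  have hp' := abs_le.mp hp
  have hq' := abs_le.mp hq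
  rw [Real.log_mul (by linarith : 0 < 1 + p).ne' (by linarith : 0 < 1 + q).ne']
  have A₀ := abs_le.mp (abs_log_one_add_le (h₀.trans (by norm_num)))
  have A₁ := abs_le.mp (abs_log_one_add_le (h₁.trans (by norm_num)))
  have A₂ := abs_le.mp (abs_log_sub_log_le hq h₂)
  have A₃ := abs_le.mp (abs_log_sub_log_le hp h₃)
  have hsq : 0 < ε ^ 2 := by positivity
  have k₀ := mul_pos hsq p₀
  have k₁ := mul_pos hsq p₁
  have k₂ := mul_pos hsq p₂
  have k₃ := mul_pos hsq p₃
  rw [abs_le]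
  constructor <;> linarith

/-- A vanishing slope would mean `s = p / (1 + u * p)` with denominator at least 1/2, hence `|s| ≤
2|p|`. -/
lemma inv_slope_ne_zero {ε k p n s u : ℝ} (hε : 72 * ε ^ 2 ≤ 1) (hε0 : 0 < ε)
    (hu : |u| ≤ ε) (hn : |p| ≤ k * ε) (hk : 0 ≤ k) (hk' : k ≤ 36) {q : ℝ} (hq : |p| ≤ q)
    (hlt : 2 * q < |s|) (h : n = slopeCB (-s) u p) : n ≠ 0 := by
  intro h0
  have hm := abs_le.mp (abs_mul_le_of hε hε0.le hk hu hn)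
  have hp : 1 / 2 ≤ 1 + u * p := by linarith
  have e : s = p / (1 + u * p) := by
    rw [h, slopeCB] at h0
    linarith
  rw [e, abs_div, abs_of_pos (show 0 < 1 + u * p by linarith), lt_div_iff₀ (by linarith)] at hlt
  nlinarith only [abs_nonneg p, hp, hlt, hq]

lemma EncounterBounds.exists_partnerCoords {ε u₁ s₁ u₂ s₂ T₁ T₂ T₃ T₄ : ℝ}
    (h : EncounterBounds ε u₁ s₁ u₂ s₂ (Real.exp (-T₁)) (Real.exp (-T₃)) (Real.exp (-T₄))
      (Real.exp (-T₂))) :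
    ∃ v₀ v₁ v₂ v₃ w₀ w₁ w₂ w₃ τ₀ τ₁ τ₂ τ₃ : ℝ,
      PartnerCoords ε u₁ s₁ u₂ s₂ T₁ T₂ T₃ T₄ v₀ v₁ v₂ v₃ w₀ w₁ w₂ w₃ τ₀ τ₁ τ₂ τ₃ := by
  obtain ⟨hε0, hε, hu₁, hs₁, hu₂, hs₂, p₀, p₁, p₂, p₃, l₀, l₁, l₂, l₃, hltu, hlts⟩ := h
  obtain ⟨v₀, v₁, v₂, v₃, ev₀, ev₁, ev₂, ev₃, bv₀, bv₁, bv₂, bv₃⟩ := exists_unstable_slopes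
    hε hε0.le hu₁ hs₁ hu₂ hs₂ p₀.le p₁.le p₂.le p₃.le l₀ l₁ l₂ l₃
  obtain ⟨n₀, n₁, n₂, n₃, en₁, en₂, en₃, en₀, bn₀, bn₁, bn₂, bn₃⟩ := exists_stable_slopes
    hε hε0.le hu₁ hs₁ hu₂ hs₂ p₀.le p₁.le p₂.le p₃.le l₀ l₁ l₂ l₃
  have h8 : ε ≤ 1 / 8 := by nlinarith
  obtain ⟨x₀, y₀, z₀⟩ := EncounterBounds.abs_slope_step hε0 hε hs₂ bv₁ (by norm_num) p₁.le l₁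
  obtain ⟨x₁, y₁, z₁⟩ := EncounterBounds.abs_slope_step hε0 hε hu₁ bv₂ (by norm_num) p₂.le l₂
  obtain ⟨x₂, y₂, z₂⟩ := EncounterBounds.abs_slope_step hε0 hε hs₂ bv₃ (by norm_num) p₃.le l₃
  obtain ⟨x₃, y₃, z₃⟩ := EncounterBounds.abs_slope_step hε0 hε hs₁ bv₀ (by norm_num) p₀.le l₀
  obtain ⟨-, y₄, z₄⟩ := EncounterBounds.abs_slope_step (R := 1) (E := 1) hε0 hε hs₁
    (by simpa using hu₁) (by norm_num) (by norm_num) le_rfl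
  obtain ⟨-, y₅, z₅⟩ := EncounterBounds.abs_slope_step (R := 1) (E := 1) hε0 hε hs₂
    (by simpa using hu₂) (by norm_num) (by norm_num) le_rfl
  obtain ⟨d₀, bw₀⟩ := abs_div_one_sub_le (R := 2)
    (abs_mul_le_twentieth hε hε0 bv₀ bn₀ p₀.le l₀ (by norm_num) (by norm_num) (by norm_num)) bn₀ (by norm_num) hε0.le
  obtain ⟨d₁, bw₁⟩ := abs_div_one_sub_le (R := 16 / 5)
    (abs_mul_le_twentieth hε hε0 bv₁ bn₁ p₁.le l₁ (by norm_num) (by norm_num) (by norm_num)) bn₁ (by norm_num) hε0.le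
  obtain ⟨d₂, bw₂⟩ := abs_div_one_sub_le (R := 3 / 2)
    (abs_mul_le_twentieth hε hε0 bv₂ bn₂ p₂.le l₂ (by norm_num) (by norm_num) (by norm_num)) bn₂ (by norm_num) hε0.le
  obtain ⟨d₃, bw₃⟩ := abs_div_one_sub_le (R := 3 / 2)
    (abs_mul_le_twentieth hε hε0 bv₃ bn₃ p₃.le l₃ (by norm_num) (by norm_num) (by norm_num)) bn₃ (by norm_num) hε0.le
  obtain ⟨N₀, N₀'⟩ := abs_contract_le hε0 p₀ l₀ bn₀ (by norm_num)
  obtain ⟨N₁, N₁'⟩ := abs_contract_le hε0 p₁ l₁ bn₁ (by norm_num)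
  obtain ⟨N₂, N₂'⟩ := abs_contract_le hε0 p₂ l₂ bn₂ (by norm_num)
  obtain ⟨N₃, N₃'⟩ := abs_contract_le hε0 p₃ l₃ bn₃ (by norm_num)
  have m₀ := abs_le.mp (abs_mul_le_of hε hε0.le (by norm_num) hu₂ N₀')
  have m₁ := abs_le.mp (abs_mul_le_of hε hε0.le (by norm_num) hs₁ N₁')
  have m₂ := abs_le.mp (abs_mul_le_of (k := 7 / 5 * (1 / 5) + 1) (q := Real.exp (-T₄) * n₂ + s₂)
    hε hε0.le (by norm_num) hu₂ ((abs_add_le _ _).trans (by linarith only [N₂', hs₂])))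
  have m₃ := abs_le.mp (abs_mul_le_of (k := 7 / 5 * (1 / 2) + 1) (q := Real.exp (-T₂) * n₃ + s₁)
    hε hε0.le (by norm_num) hu₁ ((abs_add_le _ _).trans (by linarith only [N₃', hs₁])))
  have y₀' := abs_le.mp y₀
  have y₁' := abs_le.mp y₁
  have y₂' := abs_le.mp y₂
  have y₃' := abs_le.mp y₃
  have y₄' := abs_le.mp y₄
  have y₅' := abs_le.mp y₅
  have q₂ : |-(s₂ * (v₃ - u₂))| ≤ (6 / 5 + 1) * ε / 8 ∧ |-(s₂ * (v₃ - u₂))| ≤ 1 / 16 := by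
    rw [abs_neg, mul_sub]
    constructor <;> refine (abs_sub _ _).trans ?_ <;> linarith only [y₂, y₅, z₂, z₅]
  have q₃ : |-(s₁ * (v₀ - u₁))| ≤ (5 / 4 + 1) * ε / 8 ∧ |-(s₁ * (v₀ - u₁))| ≤ 1 / 16 := by
    rw [abs_neg, mul_sub]
    constructor <;> refine (abs_sub _ _).trans ?_ <;> linarith only [y₃, y₄, z₃, z₄]
  have L₀ := abs_log_one_add_le (x := s₂ * v₁) (by linarith only [y₀])
  have L₁ := abs_log_one_add_le (x := u₁ * v₂) (by linarith only [y₁])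
  have L₂ := abs_log_one_add_le q₂.2
  have L₃ := abs_log_one_add_le q₃.2
  rw [← sub_eq_add_neg] at L₂ L₃
  have two : ∀ t : ℝ, |2 * t| = 2 * |t| := fun t => by rw [abs_mul, abs_two]
  have e₀ := passage (hop_cb (u := u₂) (s := s₂) (v := v₁) (n := n₁) (by linarith only [y₀'])
    (by linarith only [m₀] : 0 < 1 - u₂ * (Real.exp (-T₁) * n₀)).ne' d₁ en₁)
  have e₁ := passage (hop_cb (u := s₁) (s := u₁) (v := v₂) (n := n₂) (by linarith only [y₁'])
    (by linarith only [m₁] : 0 < 1 - s₁ * (Real.exp (-T₃) * n₁)).ne' d₂ en₂)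
  have e₂ := passage (hop_bc (u := u₂) (s := s₂) (v := v₃) (n := n₃)
    (by linarith only [(abs_le.mp q₂.2).1])
    (by linarith only [m₂] : 0 < 1 + u₂ * (Real.exp (-T₄) * n₂ + s₂)).ne' d₃ en₃)
  have e₃ := passage (hop_bc (u := u₁) (s := s₁) (v := v₀) (n := n₀)
    (by linarith only [(abs_le.mp q₃.2).1])
    (by linarith only [m₃] : 0 < 1 + u₁ * (Real.exp (-T₂) * n₃ + s₁)).ne' d₀ en₀)
  rw [← ev₀] at e₀
  rw [← ev₁] at e₁
  rw [← ev₂] at e₂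
  rw [← ev₃] at e₃
  refine ⟨v₀, v₁, v₂, v₃, _, _, _, _, _, _, _, _, ⟨e₀, e₁, e₂, e₃, bv₀, bv₁, bv₂, bv₃, bw₀, bw₁,
    bw₂, bw₃, ?_, ?_, ?_, ?_, ?_, ?_, ?_, ?_⟩⟩
  · rw [two]; linarith only [L₀, z₀, hε0]
  · rw [two]; linarith only [L₁, z₁, hε0]
  · rw [two]; linarith only [L₂, q₂.1, hε0]
  · rw [two]; linarith only [L₃, q₃.1, hε0]
  -- The numerator of `n₀` is `s₁` plus a term of size at most `7/5 ε e^{-T₂}`, too small to cancel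
  -- it.
  · refine div_ne_zero ?_ d₀
    rw [en₀]
    unfold slopeBC
    refine div_ne_zero ?_ ?_
    · intro h0
      have : s₁ = -(Real.exp (-T₂) * n₃) := by linarith only [h0]
      rw [this, abs_neg] at hlts
      linarith only [mul_pos hε0 p₂, mul_pos hε0 p₃, hlts, N₃]
    · have : 0 < 1 - -u₁ * (Real.exp (-T₂) * n₃ - -s₁) := by linarith only [m₃]
      exact this.ne'
  -- Here `s₁` dominates because `|s₁| > 5ε e^{-T₄}` exceeds twice `23/10 ε e^{-T₄}`.
  · rw [ev₁]
    refine mul_ne_zero p₁.ne' (inv_slope_ne_zero (s := -s₁) (k := 23 / 10 * (1 / 5))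
      (q := 23 / 10 * ε * Real.exp (-T₄)) hε hε0 hu₁ ?_ (by norm_num) (by norm_num) bv₂ ?_
      (by rw [neg_neg]))
    · refine bv₂.trans ?_
      nlinarith only [l₂, hε0]
    · rw [abs_neg]
      have h2 := mul_pos hε0 p₂
      have h3 := mul_pos hε0 p₃
      linarith only [h2, h3, hlts]
  -- Here `u₁` dominates because `|u₁| > 9ε e^{-T₃}` exceeds twice `29/10 ε e^{-T₃}`.
  · refine div_ne_zero (inv_slope_ne_zero (k := 29 / 10 * (1 / 9))
      (q := 29 / 10 * Real.exp (-T₃) * ε) hε hε0 (by rwa [abs_neg]) N₁' (by norm_num)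
      (by norm_num) N₁ ?_ en₂) d₂
    have h2 := mul_pos hε0 p₁
    linarith only [h2, hltu]
  -- The two inverse hops carry the main terms `1 + sᵢ uᵢ`; everything else is of order `ε²` times
  -- an exponential.
  · have r₂ : 1 - s₂ * (v₃ - u₂) = 1 + s₂ * u₂ - s₂ * v₃ := by ring
    have r₃ : 1 - s₁ * (v₀ - u₁) = 1 + s₁ * u₁ - s₁ * v₀ := by ring
    rw [r₂, r₃]
    have key : ∀ {R E x : ℝ}, |x| ≤ R * ε ^ 2 * E → R ≤ 3 → 0 < E → |x| ≤ 3 * ε ^ 2 * E := by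
      intro R E x hx hR hE
      refine hx.trans ?_
      have : 0 < ε ^ 2 * E := by positivity
      nlinarith only [hR, this]
    exact abs_action_le hε0 p₀ p₁ p₂ p₃ (by linarith only [y₄]) (by linarith only [y₅])
      (by linarith only [y₀]) (by linarith only [y₁]) (y₂.trans (by norm_num))
      (y₃.trans (by norm_num)) (key x₀ (by norm_num) p₁) (key x₁ (by norm_num) p₂)
      (key x₂ (by norm_num) p₃) (key x₃ (by norm_num) p₀)

end HadamardGutzwiller

/-! ### Deck transformations: excluding a return to the original orbit. -/

namespace HadamardGutzwiller

lemma eq_of_cb_eq_cb {u s u' s' : ℝ} (h : c u * b s = c u' * b s') : u = u' ∧ s = s' := by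
  unfold c b at h
  simp only [← mk_mul] at h
  obtain ⟨r, hr, e⟩ := mk_eq_mk h
  have e00 := e 0 0
  have e01 := e 0 1
  have e10 := e 1 0
  simp [sl_mul_apply, coe_bMat, coe_cMat] at e00 e01 e10
  rw [← e00] at e01 e10
  constructor <;> linarith

lemma eq_zero_of_cb_eq_a {u s t : ℝ} (h : c u * b s = a t) : u = 0 ∧ s = 0 := by
  unfold c b a at h
  simp only [← mk_mul] at h
  obtain ⟨r, hr, e⟩ := mk_eq_mk h
  have e01 := e 0 1
  have e10 := e 1 0
  simp [sl_mul_apply, coe_bMat, coe_cMat, coe_aMat] at e01 e10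
  have : r ≠ 0 := by rcases hr with rfl | rfl <;> norm_num
  exact ⟨e10.resolve_left this, e01.resolve_left this⟩

/-- An elliptic element of order two fixes a point of the upper half plane. -/
lemma exists_fixed_of_trace_zero {N : SL(2, ℝ)} (h : N.1 0 0 + N.1 1 1 = 0) :
    N.1 1 0 ≠ 0 ∧ ∃ z : ℍ, N • z = z := by
  have hd := N.2
  rw [Matrix.det_fin_two] at hd
  obtain ⟨p, hp⟩ : ∃ p, p = N.1 0 0 := ⟨_, rfl⟩
  obtain ⟨q, hq⟩ : ∃ q, q = N.1 0 1 := ⟨_, rfl⟩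
  obtain ⟨r, hr⟩ : ∃ r, r = N.1 1 0 := ⟨_, rfl⟩
  have hs : N.1 1 1 = -p := by rw [hp]; linarith
  rw [hs, ← hp, ← hq, ← hr] at hd
  have hr0 : r ≠ 0 := by
    intro h0
    rw [h0] at hd
    nlinarith [mul_self_nonneg p]
  refine ⟨by rwa [← hr], ?_⟩
  -- The fixed points are `(p ± i) / r`; the sign selects the one in the upper half plane.
  obtain ⟨κ, hκ, hpos⟩ : ∃ κ : ℝ, κ * κ = 1 ∧ 0 < κ / r := by
    rcases lt_or_gt_of_ne hr0 with h | h
    · exact ⟨-1, by norm_num, div_pos_of_neg_of_neg (by norm_num) h⟩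
    · exact ⟨1, by norm_num, by positivity⟩
  refine ⟨⟨⟨p / r, κ / r⟩, hpos⟩, ?_⟩
  ext
  rw [UpperHalfPlane.coe_specialLinearGroup_apply]
  have e00 : N 0 0 = p := hp.symm
  have e01 : N 0 1 = q := hq.symm
  have e10 : N 1 0 = r := hr.symm
  have e11 : N 1 1 = -p := hs
  rw [e00, e01, e10, e11]
  have hκ0 : κ ≠ 0 := by
    rintro rfl
    simp at hκ
  have hz : (⟨p / r, κ / r⟩ : ℂ) = (p + κ * Complex.I) / r := by
    rw [Complex.mk_eq_add_mul_I]
    push_cast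
    ring
  have hrC : (r : ℂ) ≠ 0 := by exact_mod_cast hr0
  have hκC : (κ : ℂ) ≠ 0 := by exact_mod_cast hκ0
  have hdC : (p : ℂ) * -p - q * r = 1 := by exact_mod_cast hd
  have hkC : (κ : ℂ) * κ = 1 := by exact_mod_cast hκ
  change ((p : ℂ) * (⟨p / r, κ / r⟩ : ℂ) + (q : ℂ)) /
    ((r : ℂ) * (⟨p / r, κ / r⟩ : ℂ) + ((-p : ℝ) : ℂ)) = (⟨p / r, κ / r⟩ : ℂ)
  rw [hz]
  have hden : (r : ℂ) * ((p + κ * Complex.I) / r) + ((-p : ℝ) : ℂ) = κ * Complex.I := by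
    push_cast
    field_simp
    ring
  rw [hden, div_eq_iff (mul_ne_zero hκC Complex.I_ne_zero)]
  field_simp
  have hI := Complex.I_mul_I
  linear_combination -hdC - κ * κ * hI + hkC

variable {Γ : Subgroup PSL2R}

/-- In a freely acting group no element conjugates a hyperbolic transformation to its inverse. -/
lemma ActsFreely.not_inverted (hfree : ActsFreely Γ) {m n : PSL2R} (hn : n ∈ Γ)
    (h : m * n = n * m⁻¹) {M : SL(2, ℝ)} (hM : (M : PSL2R) = m)
    (ht : 2 < M.1 0 0 + M.1 1 1) : False := by
  obtain ⟨N, rfl⟩ := mk_surj n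
  subst hM
  obtain ⟨ρ, hρ, e⟩ := mk_eq_mk (A := N * M⁻¹) (B := M * N) h.symm
  have e00 := e 0 0
  have e01 := e 0 1
  have e10 := e 1 0
  have e11 := e 1 1
  simp only [sl_mul_apply, sl_coe_inv, Matrix.of_apply, Matrix.cons_val', Matrix.cons_val_zero,
    Matrix.cons_val_one, Matrix.cons_val_fin_one] at e00 e01 e10 e11
  have hd := N.2
  have hdM := M.2
  rw [Matrix.det_fin_two] at hd hdM
  -- Conjugate matrices have equal trace and `M⁻¹` has the trace of `M`, so the sign `ρ` must be 1.
  have htr : (M.1 0 0 + M.1 1 1) * (1 - ρ) = 0 := by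
    linear_combination N.1 1 1 * e00 - N.1 0 1 * e10 - N.1 1 0 * e01 + N.1 0 0 * e11 -
      (M.1 0 0 + M.1 1 1) * (1 - ρ) * hd
  have hρ1 : ρ = 1 := by
    rcases mul_eq_zero.mp htr with h | h <;> linarith
  rw [hρ1] at e00 e01 e10 e11
  -- Otherwise the entries of `M * N = N * M⁻¹` force `M` to be scalar, contradicting its trace
  -- above 2.
  have hN : N.1 0 0 + N.1 1 1 = 0 := by
    by_contra h0
    have z01 : M.1 0 1 = 0 := by
      have : M.1 0 1 * (N.1 0 0 + N.1 1 1) = 0 := by linarith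
      exact (mul_eq_zero.mp this).resolve_right h0
    have z10 : M.1 1 0 = 0 := by
      have : M.1 1 0 * (N.1 0 0 + N.1 1 1) = 0 := by linarith
      exact (mul_eq_zero.mp this).resolve_right h0
    rw [z01, z10] at e00 e11
    rw [z01] at hdM
    have : (M.1 0 0 - M.1 1 1) * (N.1 0 0 + N.1 1 1) = 0 := by linarith
    have := (mul_eq_zero.mp this).resolve_right h0
    nlinarith
  obtain ⟨hc, z, hz⟩ := exists_fixed_of_trace_zero hN
  refine hfree N hn ?_ z hz
  intro h1
  obtain ⟨r, hr, e⟩ := mk_eq_mk (A := 1) (B := N) h1.symm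
  have := e 1 0
  simp at this
  exact hc this

lemma HasCoords.proj_eq {u s : ℝ} {g : PSL2R} {p : X Γ} (h : HasCoords Γ (proj Γ g) u s p) :
    proj Γ (g * (c u * b s)) = p := by
  obtain ⟨g', hg, rfl⟩ := h
  rw [← mul_assoc, mul_assoc, mul_assoc]
  exact proj_mul_right Γ _ hg.symm

lemma HasCoords.proj_back {u s : ℝ} {h : PSL2R} {x : X Γ} (H : HasCoords Γ x u s (proj Γ h)) :
    proj Γ (h * (b (-s) * c (-u))) = x := by
  obtain ⟨g, rfl, hg⟩ := H
  rw [proj_mul_right Γ _ hg.symm]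
  congr 1
  rw [b_neg, c_neg]
  group

/-- Lifts to `PSL(2, ℝ)` of the encounter points, in the order in which the partner visits
them. -/
structure EncounterLifts (x y z w : X Γ) (u₁ s₁ u₂ s₂ T₁ T₂ T₃ T₄ : ℝ)
    (G₀ G₁ G₂ G₃ G₄ : PSL2R) : Prop where
  eq₁ : G₁ = G₀ * a T₁ * (c u₂ * b s₂)
  eq₂ : G₂ = G₁ * a T₃ * (c s₁ * b u₁)
  eq₃ : G₃ = G₂ * a T₄ * (b (-s₂) * c (-u₂))
  eq₄ : G₄ = G₃ * a T₂ * (b (-s₁) * c (-u₁))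
  proj₀ : proj Γ G₀ = x
  proj₁ : proj Γ G₁ = timeRev Γ w
  proj₂ : proj Γ G₂ = timeRev Γ x
  proj₃ : proj Γ G₃ = y
  proj₄ : proj Γ G₄ = x

lemma exists_encounterLifts {x y z w : X Γ} {u₁ s₁ u₂ s₂ T₁ T₂ T₃ T₄ : ℝ}
    (hxy : flow Γ T₁ x = y) (hyz : flow Γ T₂ y = z) (hzw : flow Γ T₃ z = w)
    (hwx : flow Γ T₄ w = x) (hz : HasCoords Γ x u₁ s₁ z)
    (hw : HasCoords Γ y u₂ s₂ (timeRev Γ w)) :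
    ∃ G₀ G₁ G₂ G₃ G₄ : PSL2R,
      EncounterLifts x y z w u₁ s₁ u₂ s₂ T₁ T₂ T₃ T₄ G₀ G₁ G₂ G₃ G₄ := by
  obtain ⟨G₀, h0⟩ := proj_surj Γ x
  have p1 : proj Γ (G₀ * a T₁ * (c u₂ * b s₂)) = timeRev Γ w := by
    refine HasCoords.proj_eq ?_
    rwa [← flow_proj, h0, hxy]
  -- The hop from `z` back to `x`, seen in reversed time.
  have conj : c s₁ * b u₁ = dPi * (b (-s₁) * c (-u₁)) * dPi := by
    rw [mul_assoc, mul_assoc, c_mul_dPi, ← mul_assoc (b (-s₁)), b_mul_dPi, mul_assoc,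
      ← mul_assoc, dPi_mul_dPi]
    simp
  have p2 : proj Γ (G₀ * a T₁ * (c u₂ * b s₂) * a T₃ * (c s₁ * b u₁)) = timeRev Γ x := by
    have e : proj Γ (G₀ * a T₁ * (c u₂ * b s₂) * a T₃ * dPi) = z := by
      rw [← timeRev_proj, ← flow_proj, p1, timeRev_flow, timeRev_timeRev, ← hzw, flow_flow,
        add_neg_cancel, flow_zero]
    rw [conj, ← mul_assoc, ← mul_assoc, ← timeRev_proj]
    congr 1
    exact HasCoords.proj_back (by rwa [e])
  have p3 : proj Γ (G₀ * a T₁ * (c u₂ * b s₂) * a T₃ * (c s₁ * b u₁) * a T₄ *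
      (b (-s₂) * c (-u₂))) = y := by
    refine HasCoords.proj_back ?_
    rwa [← flow_proj, p2, ← hwx, timeRev_flow, flow_flow, neg_add_cancel, flow_zero]
  refine ⟨G₀, _, _, _, _, rfl, rfl, rfl, rfl, h0, p1, p2, p3, ?_⟩
  refine HasCoords.proj_back ?_
  rwa [← flow_proj, p3, hyz]

/-- The trace is `e^{t/2} + (1 + su) e^{-t/2}`. It shows that the half loop of length `T₃ + T₄`,
closed up through the encounter, is hyperbolic. -/
lemma trace_cba (u s t : ℝ) (ht : 0 < t) (hus : |s * u| ≤ 1 / 72) (hE : 7 / 9 ≤ t) :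
    2 < (cMat u * bMat s * aMat t).1 0 0 + (cMat u * bMat s * aMat t).1 1 1 := by
  have h1 : t / 2 + 1 ≤ Real.exp (t / 2) := Real.add_one_le_exp _
  have h2 : Real.exp (t / 2) * Real.exp (-t / 2) = 1 := by
    rw [← Real.exp_add]
    ring_nf
    simp
  have h3 := Real.exp_pos (-t / 2)
  have h4 := abs_le.mp hus
  simp [sl_mul_apply, coe_aMat, coe_bMat, coe_cMat]
  nlinarith

/-- If the partner returned to the original orbit, an element of the group would conjugate a
hyperbolic element to its inverse. -/
lemma EncounterLifts.not_conj (hfree : ActsFreely Γ) {x y z w : X Γ}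
    {u₁ s₁ u₂ s₂ T₁ T₂ T₃ T₄ : ℝ} {G₀ G₁ G₂ G₃ G₄ : PSL2R}
    (hL : EncounterLifts x y z w u₁ s₁ u₂ s₂ T₁ T₂ T₃ T₄ G₀ G₁ G₂ G₃ G₄)
    (hxy : flow Γ T₁ x = y) (hyz : flow Γ T₂ y = z) (hzw : flow Γ T₃ z = w)
    (hwx : flow Γ T₄ w = x) (hz : HasCoords Γ x u₁ s₁ z)
    (hus : |s₁ * u₁| ≤ 1 / 72) (hT : 7 / 9 ≤ T₃ + T₄)
    (hret : ∀ γ ∈ Γ, γ * G₀ = G₄ → γ * G₃ = G₃ * a (T₁ + T₂ + T₃ + T₄)) : False := by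
  obtain ⟨e1, e2, e3, e4, p0, p1, p2, p3, p4⟩ := hL
  have pxy : proj Γ (G₀ * a T₁) = y := by rw [← flow_proj, p0, hxy]
  have pxz : proj Γ (G₀ * a (T₁ + T₂)) = z := by
    rw [← flow_proj, p0, ← flow_flow, hxy, hyz]
  have pxw : proj Γ (G₀ * a (T₁ + T₂ + T₃)) = w := by
    rw [← flow_proj, p0, ← flow_flow, ← flow_flow, hxy, hyz, hzw]
  have pxx : proj Γ (G₀ * a (T₁ + T₂ + T₃ + T₄)) = x := by
    rw [← flow_proj, p0, ← flow_flow, ← flow_flow, ← flow_flow, hxy, hyz, hzw, hwx]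
  -- `γ` translates along the original orbit and `γ₁` closes its parallel encounter; `f₁, …, f₄`
  -- compare the lifts `Gᵢ` with that orbit or its reversal.
  obtain ⟨γ, hγ, r⟩ := (proj_eq_iff Γ _ _).mp (p0.trans pxx.symm)
  obtain ⟨γ₁, hγ₁, r1⟩ := (proj_eq_iff Γ (G₀ * a (T₁ + T₂)) (G₀ * (c u₁ * b s₁))).mp
    (pxz.trans (HasCoords.proj_eq (by rwa [p0])).symm)
  obtain ⟨f₁, hf₁, q1⟩ := (proj_eq_iff Γ (G₀ * a (T₁ + T₂ + T₃) * dPi) G₁).mp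
    (by rw [← timeRev_proj, pxw, p1])
  obtain ⟨f₂, hf₂, q2⟩ := (proj_eq_iff Γ (G₀ * dPi) G₂).mp (by rw [← timeRev_proj, p0, p2])
  obtain ⟨f₃, hf₃, q3⟩ := (proj_eq_iff Γ (G₀ * a T₁) G₃).mp (pxy.trans p3.symm)
  obtain ⟨f₄, hf₄, q4⟩ := (proj_eq_iff Γ G₀ G₄).mp (p0.trans p4.symm)
  have hr := hret f₄ hf₄ q4
  have H0 : c u₁ * b s₁ * (b (-s₁) * c (-u₁)) = 1 := by
    rw [b_neg, c_neg]; group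
  have H2 : b (-s₂) * c (-u₂) * (c u₂ * b s₂) = 1 := by
    rw [b_neg, c_neg]; group
  have conj : dPi * (c s₁ * b u₁) = b (-s₁) * c (-u₁) * dPi := by
    rw [mul_assoc, c_mul_dPi, ← mul_assoc (b (-s₁)), b_mul_dPi, mul_assoc]
    simp
  -- relations between the deck transformations
  have R1 : f₂ * γ₁ = f₁ := by
    have i1 : f₂ * G₀ * dPi = f₁ * γ₁⁻¹ * G₀ * dPi := by
      calc f₂ * G₀ * dPi = G₂ := by rw [mul_assoc, q2]
        _ = f₁ * (G₀ * a (T₁ + T₂)) * (a T₃ * dPi * a T₃) * (c s₁ * b u₁) := by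
          rw [e2, ← q1, a_add (T₁ + T₂)]; group
        _ = f₁ * (G₀ * a (T₁ + T₂)) * (dPi * (c s₁ * b u₁)) := by
          rw [a_mul_dPi, mul_assoc dPi, ← a_add, neg_add_cancel, a_zero]; group
        _ = f₁ * γ₁⁻¹ * (γ₁ * (G₀ * a (T₁ + T₂))) * (b (-s₁) * c (-u₁) * dPi) := by
          rw [conj]; group
        _ = f₁ * γ₁⁻¹ * G₀ * (c u₁ * b s₁ * (b (-s₁) * c (-u₁))) * dPi := by
          rw [r1]; group
        _ = _ := by rw [H0, mul_one]
    rw [mul_left_inj, mul_left_inj] at i1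
    rw [i1]
    group
  have R2 : f₃ * f₁ = f₂ * γ⁻¹ := by
    have i1 : f₃ * f₁ * (G₀ * a (T₁ + T₂ + T₃) * dPi) =
        f₂ * γ⁻¹ * (G₀ * a (T₁ + T₂ + T₃) * dPi) := by
      calc f₃ * f₁ * (G₀ * a (T₁ + T₂ + T₃) * dPi) = f₃ * (G₀ * a T₁) * (c u₂ * b s₂) := by
            rw [mul_assoc f₃, q1, e1]; group
        _ = G₂ * a T₄ * (b (-s₂) * c (-u₂) * (c u₂ * b s₂)) := by rw [q3, e3]; group
        _ = f₂ * (G₀ * (dPi * a T₄)) := by rw [H2, ← q2]; group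
        _ = f₂ * γ⁻¹ * (γ * G₀) * (a (-T₄) * dPi) := by
          rw [a_mul_dPi, neg_neg]; group
        _ = f₂ * γ⁻¹ * (G₀ * (a (T₁ + T₂ + T₃ + T₄) * a (-T₄)) * dPi) := by rw [r]; group
        _ = _ := by rw [← a_add, add_neg_cancel_right]
    exact mul_right_cancel i1
  have R3 : f₄ * γ₁ = f₃ := by
    have i1 : f₄ * γ₁ * (G₀ * a (T₁ + T₂)) = f₃ * (G₀ * a (T₁ + T₂)) := by
      calc f₄ * γ₁ * (G₀ * a (T₁ + T₂)) = f₄ * G₀ * (c u₁ * b s₁) := by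
            rw [mul_assoc f₄, r1]; group
        _ = G₃ * a T₂ * (b (-s₁) * c (-u₁) * (c u₁ * b s₁)) := by rw [q4, e4]; group
        _ = G₃ * a T₂ := by rw [b_neg, c_neg]; group
        _ = _ := by rw [← q3, a_add]; group
    exact mul_right_cancel i1
  have R4 : f₄ * f₃ = f₃ * γ := by
    have i1 : f₄ * f₃ * (G₀ * a T₁) = f₃ * γ * (G₀ * a T₁) := by
      calc f₄ * f₃ * (G₀ * a T₁) = G₃ * a (T₁ + T₂ + T₃ + T₄) := by rw [mul_assoc, q3, hr]
        _ = f₃ * G₀ * (a T₁ * a (T₁ + T₂ + T₃ + T₄)) := by rw [← q3]; group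
        _ = f₃ * (G₀ * a (T₁ + T₂ + T₃ + T₄)) * a T₁ := by
          rw [← a_add, add_comm T₁ (T₁ + T₂ + T₃ + T₄), a_add (T₁ + T₂ + T₃ + T₄)]; group
        _ = _ := by rw [← r]; group
    exact mul_right_cancel i1
  have hm : f₃ = γ₁ * γ := by
    have : f₄ = f₃ * γ₁⁻¹ := by rw [← R3]; group
    rw [this, mul_assoc, mul_right_inj, inv_mul_eq_iff_eq_mul] at R4
    exact R4
  -- The relations collapse to `f₃ = γ₁ * γ`, the closed-up half loop, and `f₂`, which reverses time
  -- at `x`, inverts it.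
  have hinv : f₃ * f₂ = f₂ * f₃⁻¹ := by
    have i1 : f₂ = f₁ * γ₁⁻¹ := by rw [← R1]; group
    calc f₃ * f₂ = f₃ * f₁ * γ₁⁻¹ := by rw [i1]; group
      _ = f₂ * (γ₁ * γ)⁻¹ := by rw [R2]; group
      _ = _ := by rw [hm]
  obtain ⟨A, hA⟩ := mk_surj G₀
  refine hfree.not_inverted hf₂ hinv
    (M := A * (cMat u₁ * bMat s₁ * aMat (T₃ + T₄)) * A⁻¹) ?_ ?_
  · have : ((A * (cMat u₁ * bMat s₁ * aMat (T₃ + T₄)) * A⁻¹ : SL(2, ℝ)) : PSL2R) =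
        (A : PSL2R) * (c u₁ * b s₁ * a (T₃ + T₄)) * (A : PSL2R)⁻¹ := rfl
    rw [this, hA, mul_inv_eq_iff_eq_mul, hm, mul_assoc γ₁, r,
      show T₁ + T₂ + T₃ + T₄ = (T₁ + T₂) + (T₃ + T₄) by ring, a_add (T₁ + T₂), ← mul_assoc G₀ (a _),
      ← mul_assoc γ₁, r1]
    group
  · have htr : ∀ B : SL(2, ℝ), (A * B * A⁻¹).1 0 0 + (A * B * A⁻¹).1 1 1 =
        B.1 0 0 + B.1 1 1 := by
      intro B
      have hd := A.2
      rw [Matrix.det_fin_two] at hd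
      simp only [sl_mul_apply, sl_coe_inv, Matrix.of_apply, Matrix.cons_val', Matrix.cons_val_zero,
        Matrix.cons_val_one, Matrix.cons_val_fin_one]
      linear_combination (B.1 0 0 + B.1 1 1) * hd
    rw [htr]
    exact trace_cba u₁ s₁ (T₃ + T₄) (by linarith) hus hT

end HadamardGutzwiller

/-! ### Construction of the partner orbit. -/

namespace HadamardGutzwiller

variable {Γ : Subgroup PSL2R}

lemma dG_cb_cb (g : PSL2R) (u s u' s' : ℝ) :
    dG (g * (c u * b s)) (g * (c u' * b s')) ≤ |u| + |s| + (|u'| + |s'|) := by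
  have h1 := dG_mul_cb g u s
  have h2 := dG_mul_cb g u' s'
  have h3 := dG_triangle (g * (c u * b s)) g (g * (c u' * b s'))
  rw [dG_comm (g * (c u * b s)) g] at h3
  rw [mul_assoc] at h1 h2
  linarith

/-- Points of a Poincaré section with different coordinates are different. -/
lemma IsDisplacementBound.mem_section_diff {σ₀ ε : ℝ} (hσ : IsDisplacementBound Γ σ₀)
    (hε : ε < σ₀ / 20) {G : PSL2R} {x z : X Γ} {u₁ s₁ u s : ℝ} (hG : proj Γ G = x)
    (hz : HasCoords Γ x u₁ s₁ z) (hu₁ : |u₁| < ε) (hs₁ : |s₁| < ε) (hu : |u| < 5 * ε)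
    (hs : |s| < 5 * ε) (h0 : ¬(u = 0 ∧ s = 0)) (h1 : ¬(u = u₁ ∧ s = s₁)) :
    proj Γ (G * (c u * b s)) ∈ poincareSection Γ (5 * ε) x \ {x, z} := by
  have hσ0 := hσ.1
  have hmem : HasCoords Γ x u s (proj Γ (G * (c u * b s))) := ⟨G, hG, by rw [mul_assoc]⟩
  refine ⟨⟨u, s, hu, hs, hmem⟩, ?_⟩
  rintro (h | h)
  · have h2 : proj Γ (G * (c u * b s)) = proj Γ (G * (c 0 * b 0)) := by
      rw [h, c_zero, b_zero, mul_one, mul_one, hG]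
    have h3 := hσ.proj_injOn ((dG_cb_cb G u s 0 0).trans (by simp only [abs_zero]; linarith)) h2
    exact h0 (eq_of_cb_eq_cb (mul_left_cancel h3))
  · have h2 : proj Γ (G * (c u * b s)) = proj Γ (G * (c u₁ * b s₁)) :=
      h.trans (HasCoords.proj_eq (by rwa [hG])).symm
    -- The two lifts are at most `12ε < σ₀` apart, so equality in the quotient is equality upstairs.
    have h3 := hσ.proj_injOn ((dG_cb_cb G u s u₁ s₁).trans (by linarith)) h2
    exact h1 (eq_of_cb_eq_cb (mul_left_cancel h3))

/-- The unstable offset starts at `e^{-L}` times its final bound and the stable one only shrinks, so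
both stay of order `ε` along the whole piece. -/
lemma dG_piece_le {ε v w L R W r : ℝ} (hR : 0 ≤ R * ε) (hv : |v| ≤ R * ε * Real.exp (-L))
    (hw : |w| ≤ W * ε) (hr : r ∈ Set.Icc 0 L) (G : PSL2R) :
    dG (G * a r) (G * (c v * b w) * a r) ≤ R * ε + W * ε := by
  rw [mul_assoc G (c v * b w), cb_mul_a, ← mul_assoc, ← mul_assoc]
  refine (dG_mul_cb _ _ _).trans (add_le_add ?_ ?_)
  · rw [abs_mul, abs_of_pos (Real.exp_pos r)]
    calc |v| * Real.exp r ≤ R * ε * Real.exp (-L) * Real.exp r :=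
          mul_le_mul_of_nonneg_right hv (Real.exp_pos r).le
      _ = R * ε * Real.exp (r - L) := by rw [mul_assoc, ← Real.exp_add]; ring_nf
      _ ≤ R * ε * 1 := mul_le_mul_of_nonneg_left
          (Real.exp_le_one_iff.mpr (by linarith [hr.2])) hR
      _ = R * ε := mul_one _
  · rw [abs_mul, abs_of_pos (Real.exp_pos _)]
    have : Real.exp (-r) ≤ 1 := Real.exp_le_one_iff.mpr (by linarith [hr.1])
    nlinarith [abs_nonneg w]

lemma dX_piece_lt {ε v w L R W r κ : ℝ} (hε : 0 < ε) (hR : 0 ≤ R)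
    (hv : |v| ≤ R * ε * Real.exp (-L)) (hw : |w| ≤ W * ε) (hr : r ∈ Set.Icc 0 L)
    (hRW : R + W ≤ 8) (hκ : |κ| ≤ 3 / 2 * ε) (G : PSL2R) :
    dX Γ (flow Γ r (proj Γ G)) (flow Γ (r + κ) (proj Γ (G * (c v * b w)))) < 10 * ε := by
  have h1 := dG_piece_le (by positivity) hv hw hr G
  have h2 := dX_le_dG Γ (G * a r) (G * (c v * b w) * a r)
  rw [← flow_proj, ← flow_proj] at h2
  have h3 := dX_flow_flow Γ r (r + κ) (proj Γ (G * (c v * b w)))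
  have h4 := dX_triangle Γ (flow Γ r (proj Γ G)) (flow Γ r (proj Γ (G * (c v * b w))))
    (flow Γ (r + κ) (proj Γ (G * (c v * b w))))
  have h5 : |r - (r + κ)| / Real.sqrt 2 ≤ |κ| := by
    rw [show r - (r + κ) = -κ by ring, abs_neg]
    exact div_le_self (abs_nonneg _) (Real.one_le_sqrt.mpr one_le_two)
  nlinarith

/-- Time reversal swaps the order of the `c` and `b` factors; restoring it costs a small shift in
time. -/
lemma bc_eq_cba {v w : ℝ} (h : 0 < 1 + v * w) : b (-v) * c (-w) =
    c (-w / (1 + v * w)) * b (-v * (1 + v * w)) * a (2 * Real.log (1 + v * w)) := by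
  obtain ⟨ex1, ex2⟩ := exp_half_two_log h
  unfold a b c
  simp only [← mk_mul]
  congr 1
  obtain ⟨D, hD⟩ : ∃ D, D = 1 + v * w := ⟨_, rfl⟩
  rw [← hD] at h ex1 ex2 ⊢
  have h0 := h.ne'
  apply sl_ext <;> simp [coe_aMat, coe_bMat, coe_cMat, sl_mul_apply, Real.exp_log h, ex2] <;>
    field_simp
  all_goals linarith

lemma one_sub_lt_of_exp_neg_le {T l : ℝ} (h : Real.exp (-T) ≤ l) : 1 - l ≤ T := by
  have := Real.add_one_le_exp (-T)
  linarith

/-- If the partner passed through `y`, its deck transformation would translate the original orbit's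
lift through `G₃`, the situation that `EncounterLifts.not_conj` excludes. -/
lemma PartnerCoords.ne_zero_of_lifts {σ₀ ε : ℝ} {x y z w : X Γ}
    {u₁ s₁ u₂ s₂ T₁ T₂ T₃ T₄ v₀ v₁ v₂ v₃ w₀ w₁ w₂ w₃ τ₀ τ₁ τ₂ τ₃ : ℝ} {G₀ G₁ G₂ G₃ G₄ : PSL2R}
    (hP : PartnerCoords ε u₁ s₁ u₂ s₂ T₁ T₂ T₃ T₄ v₀ v₁ v₂ v₃ w₀ w₁ w₂ w₃ τ₀ τ₁ τ₂ τ₃)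
    (hL : EncounterLifts x y z w u₁ s₁ u₂ s₂ T₁ T₂ T₃ T₄ G₀ G₁ G₂ G₃ G₄)
    (hfree : ActsFreely Γ) (hσ : IsDisplacementBound Γ σ₀) (hεσ : 20 * ε < σ₀)
    (hxy : flow Γ T₁ x = y) (hyz : flow Γ T₂ y = z) (hzw : flow Γ T₃ z = w)
    (hwx : flow Γ T₄ w = x) (hz : HasCoords Γ x u₁ s₁ z) (hsu : |s₁ * u₁| ≤ 1 / 72)
    (hT : 7 / 9 ≤ T₃ + T₄) : ¬(v₃ = 0 ∧ w₃ = 0) := by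
  have t₀ := abs_le.mp hP.hτ₀
  have t₁ := abs_le.mp hP.hτ₁
  have t₂ := abs_le.mp hP.hτ₂
  have t₃ := abs_le.mp hP.hτ₃
  obtain ⟨T', hT'⟩ : ∃ T', T' = T₁ + τ₀ + (T₃ + τ₁) + (T₄ + τ₂) + (T₂ + τ₃) := ⟨_, rfl⟩
  rintro ⟨hv, hw3⟩
  have P3 : c v₃ * b w₃ = 1 := by rw [hv, hw3, c_zero, b_zero, mul_one]
  refine hL.not_conj hfree hxy hyz hzw hwx hz hsu (by linarith) fun γ hγ hγG => ?_
  have i1 : γ * G₃ = G₃ * a T' := by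
    calc γ * G₃ = γ * (G₃ * (c v₃ * b w₃)) := by rw [P3, mul_one]
      _ = γ * (G₀ * (c v₀ * b w₀ * a (T₁ + τ₀)) * a (T₃ + τ₁) * a (T₄ + τ₂)) := by
        congr 1
        rw [hP.pass₀, mul_assoc G₀, mul_assoc G₀, mul_assoc (a T₁), mul_assoc (a T₁),
          mul_assoc (c u₂ * b s₂), mul_assoc (c u₂ * b s₂), hP.pass₁, mul_assoc (a T₃),
          mul_assoc (c s₁ * b u₁), hP.pass₂, hL.eq₃, hL.eq₂, hL.eq₁]
        simp only [mul_assoc]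
      _ = γ * G₀ * (c v₀ * b w₀) * a (T₁ + τ₀ + (T₃ + τ₁) + (T₄ + τ₂)) := by
        simp only [a_add, mul_assoc]
      _ = G₃ * (a T₂ * (b (-s₁) * c (-u₁) * (c v₀ * b w₀))) *
          a (T₁ + τ₀ + (T₃ + τ₁) + (T₄ + τ₂)) := by
        rw [hγG, hL.eq₄]
        simp only [mul_assoc]
      _ = G₃ * a T' := by
        rw [← hP.pass₃, P3, one_mul, hT', mul_assoc, ← a_add]
        congr 2
        ring
  rw [i1]
  -- Both flow times return `y` to itself, and they differ by less than `3ε`; the displacement bound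
  -- identifies the two lifts.
  have hd : dG (G₃ * a T') (G₃ * a (T₁ + T₂ + T₃ + T₄)) ≤ σ₀ := by
    refine (dG_mul_a_mul_a _ _ _).trans ((div_le_self (abs_nonneg _)
      (Real.one_le_sqrt.mpr one_le_two)).trans ?_)
    rw [hT', abs_le]
    constructor <;> linarith
  refine hσ.proj_injOn hd ?_
  rw [← i1, proj_mul_left Γ hγ, ← flow_proj, hL.proj₃, ← hxy, flow_flow,
    show T₁ + (T₁ + T₂ + T₃ + T₄) = T₁ + T₂ + T₃ + T₄ + T₁ by ring, ← flow_flow,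
    ← flow_flow, ← flow_flow, ← flow_flow, hxy, hyz, hzw, hwx, hxy]

lemma abs_two_mul_log_lt {ε v w : ℝ} (hε0 : 0 < ε) (hε : ε ≤ 1 / 8) (hv : |v| ≤ ε / 2)
    (hw : |w| ≤ 3 / 2 * ε) : |2 * Real.log (1 + v * w)| < ε := by
  have h2 : |v * w| ≤ ε / 2 * (3 / 2 * ε) := by
    rw [abs_mul]
    exact mul_le_mul hv hw (abs_nonneg _) (by positivity)
  have h3 : |v * w| ≤ 3 / 32 * ε := by nlinarith only [h2, hε, hε0]
  have h1 := abs_log_one_add_le (h3.trans (by linarith))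
  rw [abs_mul, abs_two]
  linarith

/-- The time reversal of a passage through a section, moved along the flow, is one as well. -/
lemma cb_mul_a_mul_dPi {v w : ℝ} (h : 0 < 1 + v * w) (G : PSL2R) :
    G * (c v * b w) * a (2 * Real.log (1 + v * w)) * dPi = G * dPi *
        (c (-w / (1 + v * w)) * b (-v * (1 + v * w))) := by
  rw [mul_assoc _ (a _), a_mul_dPi, a_neg, mul_assoc, ← mul_assoc (c v * b w),
    mul_assoc (c v), b_mul_dPi, ← mul_assoc (c v), c_mul_dPi, mul_assoc dPi, bc_eq_cba h]
  group

/-- The partner orbit, with a closeness that is better than required. -/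
theorem exists_reconnectedPartner (hfree : ActsFreely Γ) {σ₀ ε : ℝ}
    (hσ : IsDisplacementBound Γ σ₀) (hε0 : 0 < ε) (hεσ : ε < σ₀ / 20) {x y z w : X Γ}
    {T₁ T₂ T₃ T₄ : ℝ} (hT₁ : 0 < T₁)
    (hxy : flow Γ T₁ x = y) (hyz : flow Γ T₂ y = z) (hzw : flow Γ T₃ z = w)
    (hwx : flow Γ T₄ w = x) {u₁ s₁ u₂ s₂ : ℝ} (hu₁ : |u₁| < ε) (hs₁ : |s₁| < ε)
    (hu₂ : |u₂| < ε) (hs₂ : |s₂| < ε) (hz : HasCoords Γ x u₁ s₁ z)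
    (hw : HasCoords Γ y u₂ s₂ (timeRev Γ w)) (hlu : 9 * ε * Real.exp (-T₃) < |u₁|)
    (hls : 72 * ε ^ 3 + 5 * ε * Real.exp (-T₄) + 2 * ε * Real.exp (-T₂) < |s₁|) :
    ∃ (O' : Set (X Γ)) (T' : ℝ) (x' : X Γ) (t' : Fin 5 → ℝ),
      IsReconnectedPartner Γ ε (10 * ε) x T₁ T₂ T₃ T₄ O' T' x' t' ∧
      AvoidsPiercingPoints Γ ε x y z w x' t' ∧
      |(T' - (T₁ + T₂ + T₃ + T₄)) / 2 - Real.log ((1 + s₁ * u₁) * (1 + s₂ * u₂))| ≤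
        25 * ε ^ 2 * (Real.exp (-T₁) + Real.exp (-T₂) + Real.exp (-T₃) + Real.exp (-T₄)) := by
  have E₁ := Real.exp_pos (-T₁)
  have E₂ := Real.exp_pos (-T₂)
  have E₃ := Real.exp_pos (-T₃)
  have E₄ := Real.exp_pos (-T₄)
  have m₂ := mul_pos hε0 E₂
  have m₃ := mul_pos hε0 E₃
  have m₄ := mul_pos hε0 E₄
  have hc3 : 0 < ε ^ 3 := by positivity
  -- All smallness is extracted from `|u₁|, |s₁| < ε`: the cubic term bounds `ε`, and the
  -- exponential terms bound `e^{-T₃}, e^{-T₄}, e^{-T₂}` by `1/9, 1/5, 1/2`.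
  have hsm : 72 * ε ^ 2 ≤ 1 := by
    by_contra h
    nlinarith
  have l₃ : Real.exp (-T₃) ≤ 1 / 9 := by
    by_contra h
    nlinarith
  have l₄ : Real.exp (-T₄) ≤ 1 / 5 := by
    by_contra h
    nlinarith
  have l₂ : Real.exp (-T₂) ≤ 1 / 2 := by
    by_contra h
    nlinarith
  have l₁ : Real.exp (-T₁) ≤ 1 := Real.exp_le_one_iff.mpr (by linarith)
  have h8 : ε ≤ 1 / 8 := by nlinarith
  have hT₂ := one_sub_lt_of_exp_neg_le l₂
  have hT₃ := one_sub_lt_of_exp_neg_le l₃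
  have hT₄ := one_sub_lt_of_exp_neg_le l₄
  obtain ⟨v₀, v₁, v₂, v₃, w₀, w₁, w₂, w₃, τ₀, τ₁, τ₂, τ₃, hP⟩ :=
    EncounterBounds.exists_partnerCoords (ε := ε) (u₁ := u₁) (s₁ := s₁) (u₂ := u₂) (s₂ := s₂)
      (T₁ := T₁) (T₂ := T₂) (T₃ := T₃) (T₄ := T₄)
      ⟨hε0, hsm, hu₁.le, hs₁.le, hu₂.le, hs₂.le, E₁, E₃, E₄, E₂, l₁, l₃, l₄, l₂, hlu,
        by linarith⟩
  obtain ⟨G₀, G₁, G₂, G₃, G₄, hL⟩ := exists_encounterLifts hxy hyz hzw hwx hz hw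
  -- the partner orbit passes the lifts of the encounter points
  obtain ⟨x', hx'⟩ : ∃ x', x' = proj Γ (G₀ * (c v₀ * b w₀)) := ⟨_, rfl⟩
  have f₁ : flow Γ (T₁ + τ₀) x' = proj Γ (G₁ * (c v₁ * b w₁)) := by
    rw [hx', flow_proj, mul_assoc G₀, hP.pass₀, hL.eq₁]
    simp only [mul_assoc]
  have f₂ : flow Γ (T₃ + τ₁) (proj Γ (G₁ * (c v₁ * b w₁))) = proj Γ (G₂ * (c v₂ * b w₂)) := by
    rw [flow_proj, mul_assoc G₁, hP.pass₁, hL.eq₂]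
    simp only [mul_assoc]
  have f₃ : flow Γ (T₄ + τ₂) (proj Γ (G₂ * (c v₂ * b w₂))) = proj Γ (G₃ * (c v₃ * b w₃)) := by
    rw [flow_proj, mul_assoc G₂, hP.pass₂, hL.eq₃]
    simp only [mul_assoc]
  have f₄ : flow Γ (T₂ + τ₃) (proj Γ (G₃ * (c v₃ * b w₃))) = x' := by
    rw [flow_proj, mul_assoc G₃, hP.pass₃, hx',
      proj_mul_right Γ _ (hL.proj₀.trans hL.proj₄.symm), hL.eq₄]
    simp only [mul_assoc]
  have F₂ : flow Γ (T₁ + τ₀ + (T₃ + τ₁)) x' = proj Γ (G₂ * (c v₂ * b w₂)) := by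
    rw [← flow_flow, f₁, f₂]
  have F₃ : flow Γ (T₁ + τ₀ + (T₃ + τ₁) + (T₄ + τ₂)) x' = proj Γ (G₃ * (c v₃ * b w₃)) := by
    rw [← flow_flow, F₂, f₃]
  have F₄ : flow Γ (T₁ + τ₀ + (T₃ + τ₁) + (T₄ + τ₂) + (T₂ + τ₃)) x' = x' := by
    rw [← flow_flow, F₃, f₄]
  have t₀ := abs_le.mp hP.hτ₀
  have t₁ := abs_le.mp hP.hτ₁
  have t₂ := abs_le.mp hP.hτ₂
  have t₃ := abs_le.mp hP.hτ₃
  obtain ⟨T', hT'⟩ : ∃ T', T' = T₁ + τ₀ + (T₃ + τ₁) + (T₄ + τ₂) + (T₂ + τ₃) := ⟨_, rfl⟩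
  rw [← hT'] at F₄
  have hsu : |s₁ * u₁| ≤ 1 / 72 := by
    have := abs_mul_le_of hsm hε0.le zero_le_one hs₁.le (q := u₁) (by linarith)
    exact this
  -- the partner differs from the original orbit
  have hne₃ := hP.ne_zero_of_lifts hL hfree hσ (by linarith) hxy hyz hzw hwx hz hsu
    (by linarith)
  -- Meeting a second encounter point would cancel the next or the preceding hop, making a
  -- coordinate of the neighbouring passage vanish.
  have hne₀ : ¬(v₀ = u₁ ∧ w₀ = s₁) := by
    rintro ⟨hv, hw0⟩
    have e : c v₃ * b w₃ * a (T₂ + τ₃) = a T₂ := by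
      rw [hP.pass₃, hv, hw0, b_neg, c_neg]
      group
    refine hne₃ (eq_zero_of_cb_eq_a (t := T₂ + -(T₂ + τ₃)) ?_)
    rw [a_add, a_neg, ← e]
    group
  have hne₁ : ¬(v₀ * Real.exp T₁ = u₂ ∧ w₀ * Real.exp (-T₁) = s₂) := by
    rintro ⟨hv, hw0⟩
    have e := hP.pass₀
    rw [a_add, ← mul_assoc (c v₀ * b w₀), cb_mul_a, hv, hw0, mul_assoc (a T₁)] at e
    exact hP.v₁_ne (eq_zero_of_cb_eq_a (mul_left_cancel (mul_left_cancel e)).symm).1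
  have hne₂ : ¬(v₃ = u₂ ∧ w₃ = s₂) := by
    rintro ⟨hv, hw3⟩
    have e : c v₂ * b w₂ * a (T₄ + τ₂) = a T₄ := by
      rw [hP.pass₂, hv, hw3, b_neg, c_neg]
      group
    refine hP.w₂_ne (eq_zero_of_cb_eq_a (u := v₂) (t := T₄ + -(T₄ + τ₂)) ?_).2
    rw [a_add, a_neg, ← e]
    group
  have r₁ : timeRev Γ (proj Γ G₁) = w := by rw [hL.proj₁, timeRev_timeRev]
  have r₂ : timeRev Γ (proj Γ G₂) = x := by rw [hL.proj₂, timeRev_timeRev]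
  have p₀ : |τ₀ + τ₁| ≤ 5 / 6 * ε := abs_le.mpr ⟨by linarith, by linarith⟩
  have close₀ : ∀ r ∈ Set.Icc 0 T₁, dX Γ (flow Γ r x) (flow Γ (r + 0) x') < 10 * ε := by
    intro r hr
    have := dX_piece_lt (Γ := Γ) (κ := 0) hε0 (by norm_num) hP.hv₀ hP.hw₀ hr (by norm_num)
      (by rw [abs_zero]; linarith) G₀
    rwa [hL.proj₀, ← hx'] at this
  have close₃ : ∀ r ∈ Set.Icc 0 T₂, dX Γ (flow Γ (r + T₁) x)
      (flow Γ (r + (T₁ + τ₀ + (T₃ + τ₁) + (T₄ + τ₂))) x') < 10 * ε := by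
    intro r hr
    have := dX_piece_lt (Γ := Γ) (κ := 0) hε0 (by norm_num) hP.hv₃ hP.hw₃ hr (by norm_num)
      (by rw [abs_zero]; linarith) G₃
    rwa [hL.proj₃, ← F₃, ← hxy, flow_flow, flow_flow, add_zero, add_comm T₁ r,
      add_comm _ r] at this
  have close₁ : ∀ r ∈ Set.Icc 0 T₃, dX Γ (flow Γ (r + (T₁ + T₂)) x)
      (flow Γ (r - (T₁ + τ₀ + (T₃ + τ₁))) (timeRev Γ x')) < 10 * ε := by
    intro r hr
    have := dX_piece_lt (Γ := Γ) (κ := τ₁) (r := T₃ - r) hε0 (by norm_num) hP.hv₁ hP.hw₁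
      ⟨by linarith [hr.2], by linarith [hr.1]⟩ (by norm_num) (hP.hτ₁.trans (by linarith)) G₁
    rw [← f₁, flow_flow, ← dX_timeRev, timeRev_flow, timeRev_flow, r₁, ← hzw, ← hyz, ← hxy] at this
    simp only [flow_flow] at this
    convert this using 3 <;> ring
  have close₂ : ∀ r ∈ Set.Icc 0 T₄, dX Γ (flow Γ (r + (T₁ + T₂ + T₃)) x)
      (flow Γ (r - (T₁ + τ₀ + (T₃ + τ₁) + (T₄ + τ₂))) (timeRev Γ x')) < 10 * ε := by
    intro r hr
    have := dX_piece_lt (Γ := Γ) (κ := τ₂) (r := T₄ - r) hε0 (by norm_num) hP.hv₂ hP.hw₂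
      ⟨by linarith [hr.2], by linarith [hr.1]⟩ (by norm_num) (hP.hτ₂.trans (by linarith)) G₂
    rw [← F₂, flow_flow, ← dX_timeRev, timeRev_flow, timeRev_flow, r₂] at this
    have e : flow Γ (-(T₄ - r)) x = flow Γ (r + (T₁ + T₂ + T₃)) x := by
      conv_lhs => rw [← hwx, ← hzw, ← hyz, ← hxy]
      simp only [flow_flow]
      congr 1
      ring
    rw [e] at this
    convert this using 3
    ring
  have hv₂w₂ := abs_mul_le_twentieth hsm hε0 hP.hv₂ hP.hw₂ E₄.le l₄ (by norm_num) (by norm_num)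
    (by norm_num)
  have hD := abs_le.mp hv₂w₂
  have hD0 : 0 < 1 + v₂ * w₂ := by linarith
  -- The second cut is at `T₁`, not at `T₁ + τ₀`: there the partner is in the section at `y`,
  -- whereas `G₁` lies over the reversal of `w`. The piece of length `T₃` then absorbs `τ₀ + τ₁`, at
  -- most `5/6 ε`. The third crossing is shifted by the logarithm from `bc_eq_cba`.
  refine ⟨orbit Γ x', T', x', ![0, T₁, T₁ + τ₀ + (T₃ + τ₁),
    T₁ + τ₀ + (T₃ + τ₁) + (T₄ + τ₂), T'], ?_, ⟨⟨0, ?_, ?_⟩, ⟨T₁, ?_, ?_⟩,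
    ⟨T₁ + τ₀ + (T₃ + τ₁) + 2 * Real.log (1 + v₂ * w₂), ?_, ?_⟩,
    ⟨T₁ + τ₀ + (T₃ + τ₁) + (T₄ + τ₂), ?_, ?_⟩⟩, ?_⟩
  · rw [isReconnectedPartner_iff]
    refine ⟨⟨by linarith, x', F₄, rfl⟩, ⟨0, flow_zero Γ x'⟩, ?_, rfl, rfl,
      ⟨close₀, close₃, close₁, close₂⟩, ?_, ?_, ?_, ?_⟩
    · rw [Fin.strictMono_iff_lt_succ]
      intro i
      fin_cases i
      · exact hT₁
      · change T₁ < T₁ + τ₀ + (T₃ + τ₁)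
        linarith
      · change T₁ + τ₀ + (T₃ + τ₁) < T₁ + τ₀ + (T₃ + τ₁) + (T₄ + τ₂)
        linarith
      · change T₁ + τ₀ + (T₃ + τ₁) + (T₄ + τ₂) < T'
        linarith
    · change |T₁ - 0 - T₁| < ε
      rw [sub_zero, sub_self, abs_zero]
      exact hε0
    · change |T' - (T₁ + τ₀ + (T₃ + τ₁) + (T₄ + τ₂)) - T₂| < ε
      rw [abs_lt]
      constructor <;> linarith
    · change |T₁ + τ₀ + (T₃ + τ₁) - T₁ - T₃| < ε
      rw [abs_lt]
      constructor <;> linarith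
    · change |T₁ + τ₀ + (T₃ + τ₁) + (T₄ + τ₂) - (T₁ + τ₀ + (T₃ + τ₁)) - T₄| < ε
      rw [abs_lt]
      constructor <;> linarith
  · change |(0 : ℝ) - 0| < ε
    rwa [sub_zero, abs_zero]
  · rw [flow_zero, hx']
    exact hσ.mem_section_diff hεσ hL.proj₀ hz hu₁ hs₁ (hP.hv₀.trans_lt (by nlinarith only [l₁, hε0]))
      (hP.hw₀.trans_lt (by linarith)) (fun h => hP.w₀_ne h.2) hne₀
  · change |T₁ - T₁| < ε
    rwa [sub_self, abs_zero]
  · rw [hx', flow_proj, mul_assoc, cb_mul_a, ← mul_assoc]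
    have hv : |v₀ * Real.exp T₁| < 5 * ε := by
      rw [abs_mul, abs_of_pos (Real.exp_pos _)]
      calc |v₀| * Real.exp T₁ ≤ 5 / 4 * ε * Real.exp (-T₁) * Real.exp T₁ :=
            mul_le_mul_of_nonneg_right hP.hv₀ (Real.exp_pos _).le
        _ = 5 / 4 * ε := by rw [mul_assoc, ← Real.exp_add, neg_add_cancel, Real.exp_zero, mul_one]
        _ < 5 * ε := by linarith
    have hw' : |w₀ * Real.exp (-T₁)| < 5 * ε := by
      rw [abs_mul, abs_of_pos E₁]
      exact (mul_le_of_le_one_right (abs_nonneg _) l₁).trans_lt (hP.hw₀.trans_lt (by linarith))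
    exact hσ.mem_section_diff hεσ (by rw [← flow_proj, hL.proj₀, hxy]) hw hu₂ hs₂ hv hw'
      (fun h => (mul_ne_zero hP.w₀_ne E₁.ne') h.2) hne₁
  · change |T₁ + τ₀ + (T₃ + τ₁) + 2 * Real.log (1 + v₂ * w₂) - (T₁ + τ₀ + (T₃ + τ₁))| < ε
    rw [add_sub_cancel_left]
    exact abs_two_mul_log_lt hε0 h8 (hP.hv₂.trans (by nlinarith only [l₄, hε0])) hP.hw₂
  · rw [← flow_flow, F₂, flow_proj, timeRev_proj]
    rw [cb_mul_a_mul_dPi hD0]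
    have hv : |-v₂ * (1 + v₂ * w₂)| ≤ 21 / 20 * (23 / 10 * ε * Real.exp (-T₄)) := by
      rw [abs_mul, abs_neg, abs_of_pos hD0]
      nlinarith only [abs_nonneg v₂, hP.hv₂, hD]
    have hw' : |-w₂ / (1 + v₂ * w₂)| < 5 * ε := by
      rw [abs_div, abs_neg, abs_of_pos hD0, div_lt_iff₀ hD0]
      nlinarith only [hP.hw₂, hD, hε0]
    refine hσ.mem_section_diff hεσ (by rw [← timeRev_proj, r₂]) hz hu₁ hs₁ hw'
      (hv.trans_lt (by nlinarith only [l₄, hε0])) (fun h => ?_) (fun h => ?_)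
    · exact div_ne_zero (neg_ne_zero.mpr hP.w₂_ne) hD0.ne' h.1
    -- The second coordinate is below `5ε e^{-T₄}`, hence smaller than `|s₁|`.
    · rw [h.2] at hv
      linarith
  · change |T₁ + τ₀ + (T₃ + τ₁) + (T₄ + τ₂) - (T₁ + τ₀ + (T₃ + τ₁) + (T₄ + τ₂))| < ε
    rwa [sub_self, abs_zero]
  · rw [F₃]
    exact hσ.mem_section_diff hεσ hL.proj₃ hw hu₂ hs₂ (hP.hv₃.trans_lt (by nlinarith only [l₂, hε0]))
      (hP.hw₃.trans_lt (by linarith)) hne₃ hne₂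
  · have e : T' - (T₁ + T₂ + T₃ + T₄) = τ₀ + τ₁ + τ₂ + τ₃ := by
      rw [hT']
      ring
    rw [e]
    exact hP.action

end HadamardGutzwiller

/-! ### Assembly of existence, action estimate and uniqueness. -/

theorem mainTheorem3 (Γ : Subgroup HadamardGutzwiller.PSL2R) [DiscreteTopology Γ]
    [CompactSpace (HadamardGutzwiller.X Γ)] (hfree : HadamardGutzwiller.ActsFreely Γ)
    (σ₀ : ℝ) (hσ₀ : HadamardGutzwiller.IsDisplacementBound Γ σ₀) :
    (∃ εs : ℝ, HadamardGutzwiller.IsCoincidenceConst Γ εs) ∧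
    ∀ (ε : ℝ), 0 < ε → ε < σ₀ / 20 →
    ∀ (O : Set (HadamardGutzwiller.X Γ)) (T : ℝ), 1 < T →
      HadamardGutzwiller.IsPeriodicOrbit Γ O T →
    ∀ x ∈ O, ∀ y ∈ O, ∀ z ∈ O, ∀ w ∈ O,
    ∀ T₁ T₂ T₃ T₄ : ℝ, 0 < T₁ → 0 < T₂ → 0 < T₃ → 0 < T₄ → T₁ + T₂ + T₃ + T₄ = T →
      HadamardGutzwiller.flow Γ T₁ x = y → HadamardGutzwiller.flow Γ T₂ y = z →
      HadamardGutzwiller.flow Γ T₃ z = w → HadamardGutzwiller.flow Γ T₄ w = x →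
    ∀ u₁ s₁ u₂ s₂ : ℝ, |u₁| < ε → |s₁| < ε → |u₂| < ε → |s₂| < ε →
      HadamardGutzwiller.HasCoords Γ x u₁ s₁ z →
      HadamardGutzwiller.HasCoords Γ y u₂ s₂ (HadamardGutzwiller.timeRev Γ w) →
      9 * ε * Real.exp (-T₃) < |u₁| →
      72 * ε ^ 3 + 5 * ε * Real.exp (-T₄) + 2 * ε * Real.exp (-T₂) < |s₁| →
    (∃ (O' : Set (HadamardGutzwiller.X Γ)) (T' : ℝ) (x' : HadamardGutzwiller.X Γ)
        (t' : Fin 5 → ℝ),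
      HadamardGutzwiller.IsPartnerOrbit Γ (19 * ε) O T O' T' ∧
      HadamardGutzwiller.IsReconnectedPartner Γ ε (19 * ε) x T₁ T₂ T₃ T₄ O' T' x' t' ∧
      HadamardGutzwiller.AvoidsPiercingPoints Γ ε x y z w x' t' ∧
      |(T' - T) / 2 - Real.log ((1 + s₁ * u₁) * (1 + s₂ * u₂))| ≤
        54 * ε ^ 4 + 25 * ε ^ 2 *
          (Real.exp (-T₁) + Real.exp (-T₂) + Real.exp (-T₃) + Real.exp (-T₄))) ∧
    (∀ εs : ℝ, HadamardGutzwiller.IsCoincidenceConst Γ εs → ε < εs / 38 →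
      ∀ (O' O'' : Set (HadamardGutzwiller.X Γ)) (T' T'' : ℝ)
        (x' x'' : HadamardGutzwiller.X Γ) (t' t'' : Fin 5 → ℝ),
      HadamardGutzwiller.IsReconnectedPartner Γ ε (19 * ε) x T₁ T₂ T₃ T₄ O' T' x' t' →
      HadamardGutzwiller.IsReconnectedPartner Γ ε (19 * ε) x T₁ T₂ T₃ T₄ O'' T'' x'' t'' →
      T' = T'' ∧ O' = O'') := by
  refine ⟨⟨σ₀ / 3, hσ₀.isCoincidenceConst⟩, ?_⟩
  intro ε hε0 hεσ O T _ hO x hx y _ z _ w _ T₁ T₂ T₃ T₄ hT₁ hT₂ hT₃ hT₄ hT hxy hyz hzw hwx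
    u₁ s₁ u₂ s₂ hu₁ hs₁ hu₂ hs₂ hz hw hlu hls
  obtain ⟨O', T', x', t', hp, ha, hact⟩ := HadamardGutzwiller.exists_reconnectedPartner hfree hσ₀
    hε0 hεσ hT₁ hxy hyz hzw hwx hu₁ hs₁ hu₂ hs₂ hz hw hlu hls
  refine ⟨⟨O', T', x', t', ?_, hp.mono (by linarith), ha, ?_⟩, ?_⟩
  · obtain ⟨h1, h2, h3, h4, h5, h6, -⟩ := hp.mono (show 10 * ε ≤ 19 * ε by linarith)
    refine ⟨hO, h1, 4, _, t', _, _, x, x', by norm_num, ?_, rfl, hT, h3, h4, h5, hx, h2, h6⟩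
    rw [Fin.strictMono_iff_lt_succ]
    intro i
    fin_cases i
    · exact hT₁
    · exact lt_add_of_pos_right _ hT₂
    · exact lt_add_of_pos_right _ hT₃
    · exact lt_add_of_pos_right _ hT₄
  · rw [hT] at hact
    have : 0 < ε ^ 4 := by positivity
    linarith
  · intro εs hεs hlt O₁ O₂ P₁ P₂ x₁ x₂ t₁ t₂ h₁ h₂
    -- Both partners are compared with the constructed `10ε`-close one; a direct comparison of two
    -- `19ε`-partners would use up `38ε` before any time shift.
    obtain ⟨p₁, o₁⟩ := hεs.eq_partner hε0 hlt hT₁ hT₂ hT₃ hT₄ h₁ hp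
    obtain ⟨p₂, o₂⟩ := hεs.eq_partner hε0 hlt hT₁ hT₂ hT₃ hT₄ h₂ hp
    exact ⟨p₁.trans p₂.symm, o₁.trans o₂.symm⟩
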